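/- Computational model: a deterministic random access machine with exact real arithmetic. Each operation $+,-,\cdot,/$, each comparison and each memory access for real numbers costs one step (no rounding, no conversion of reals to integers, and the only constants in a program are natural numbers); operations $+$, truncated $-$, $\cdot$, integer division, remainder and comparison on machine integers, which serve as counters and addresses, also cost one step each. All integers used must be bounded by a word bound $W\ge n$. Memory is initially zero except for the input. Theorem. There are a single program and absolute constants $C,k\in\mathbb N$ such that, for every $n\ge 1$, every real $\epsilon>0$ and every matrix $A\in[-1,1]^{n\times n}$, the program on input $(n,\epsilon,A)$, run with some word bound $n\le W\le C\,(n\max(1,1/\epsilon))^{k}$, halts after at most $C\max(1,1/\epsilon)^{k}\,n^2$ steps and outputs an integer $0\le r\le C\epsilon^{-16}$, subsets $S_1,\dots,S_r,T_1,\dots,T_r\subseteq[n]$ (as $0/1$ incidence vectors) and real numbers $c_1,\dots,c_r\in\{-\frac{\epsilon^8}{300},\frac{\epsilon^8}{300}\}$ such that, setting $$A'=\sum_{i=1}^r c_i\mathbf 1_{S_i}\mathbf 1_{T_i}^\top ,$$ where $\mathbf 1_S\in\mathbb R^n$ denotes the characteristic vector of $S$, the sum of the squares of the entries of each row and of each column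 of $A-A'$ is at most $n$, and $$\|A-A'\|\le \epsilon n ,$$ where $\|\cdot\|$ is the spectral norm (the operator norm with respect to the Euclidean norm). -/

import Mathlib

/-! A real random access machine. Programs are finite syntax trees of a structured imperative
language. Real numbers are exact, and one arithmetic operation or comparison of reals costs one
step; there is no rounding and no conversion of reals to integers. Natural numbers serve as
counters and addresses; operations on them also cost one step, but they live in machine words:
an operation whose result exceeds the word bound `W` has no result, and the program is stuck. -/

namespace RealRAM

/-- The memory: scalar variables and arrays (the first argument is the name of the variable or of
the array, the second the address), holding natural numbers and real numbers. -/
structure State where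
  ivar : ℕ → ℕ
  rvar : ℕ → ℝ
  iarr : ℕ → ℕ → ℕ
  rarr : ℕ → ℕ → ℝ

/-- Integer expressions: literals, variables, array entries, and the operations
`+`, truncated `-`, `*`, integer division and remainder. -/
inductive IExp where
  | lit (c : ℕ)
  | var (x : ℕ)
  | load (a : ℕ) (i : IExp)
  | add (e₁ e₂ : IExp)
  | sub (e₁ e₂ : IExp)
  | mul (e₁ e₂ : IExp)
  | div (e₁ e₂ : IExp)
  | mod (e₁ e₂ : IExp)

namespace IExp

def val (s : State) : IExp → ℕ
  | lit c => c
  | var x => s.ivar x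
  | load a i => s.iarr a (i.val s)
  | add e₁ e₂ => e₁.val s + e₂.val s
  | sub e₁ e₂ => e₁.val s - e₂.val s
  | mul e₁ e₂ => e₁.val s * e₂.val s
  | div e₁ e₂ => e₁.val s / e₂.val s
  | mod e₁ e₂ => e₁.val s % e₂.val s

/-- The evaluation neither overflows the word bound `W` nor divides by zero.
Loads and the operations `-`, `/`, `%` produce no value larger than those already present. -/
def Safe (W : ℕ) (s : State) : IExp → Prop
  | lit c => c ≤ W
  | var _ => True
  | load _ i => i.Safe W s
  | add e₁ e₂ => e₁.Safe W s ∧ e₂.Safe W s ∧ e₁.val s + e₂.val s ≤ W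
  | sub e₁ e₂ => e₁.Safe W s ∧ e₂.Safe W s
  | mul e₁ e₂ => e₁.Safe W s ∧ e₂.Safe W s ∧ e₁.val s * e₂.val s ≤ W
  | div e₁ e₂ => e₁.Safe W s ∧ e₂.Safe W s ∧ e₂.val s ≠ 0
  | mod e₁ e₂ => e₁.Safe W s ∧ e₂.Safe W s ∧ e₂.val s ≠ 0

/-- The number of steps of the evaluation: one for each literal, memory access and operation. -/
def cost : IExp → ℕ
  | lit _ => 1
  | var _ => 1
  | load _ i => i.cost + 1
  | add e₁ e₂ => e₁.cost + e₂.cost + 1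
  | sub e₁ e₂ => e₁.cost + e₂.cost + 1
  | mul e₁ e₂ => e₁.cost + e₂.cost + 1
  | div e₁ e₂ => e₁.cost + e₂.cost + 1
  | mod e₁ e₂ => e₁.cost + e₂.cost + 1

end IExp

/-- Real expressions: variables, array entries, integers read as reals, and the four operations.
The only constants of a program are natural numbers. -/
inductive RExp where
  | ofNat (e : IExp)
  | var (x : ℕ)
  | load (a : ℕ) (i : IExp)
  | add (e₁ e₂ : RExp)
  | sub (e₁ e₂ : RExp)
  | mul (e₁ e₂ : RExp)
  | div (e₁ e₂ : RExp)

namespace RExp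

noncomputable def val (s : State) : RExp → ℝ
  | ofNat e => (e.val s : ℝ)
  | var x => s.rvar x
  | load a i => s.rarr a (i.val s)
  | add e₁ e₂ => e₁.val s + e₂.val s
  | sub e₁ e₂ => e₁.val s - e₂.val s
  | mul e₁ e₂ => e₁.val s * e₂.val s
  | div e₁ e₂ => e₁.val s / e₂.val s

/-- The integer parts are safe and there is no division by zero. -/
def Safe (W : ℕ) (s : State) : RExp → Prop
  | ofNat e => e.Safe W s
  | var _ => True
  | load _ i => i.Safe W s
  | add e₁ e₂ => e₁.Safe W s ∧ e₂.Safe W s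
  | sub e₁ e₂ => e₁.Safe W s ∧ e₂.Safe W s
  | mul e₁ e₂ => e₁.Safe W s ∧ e₂.Safe W s
  | div e₁ e₂ => e₁.Safe W s ∧ e₂.Safe W s ∧ e₂.val s ≠ 0

def cost : RExp → ℕ
  | ofNat e => e.cost + 1
  | var _ => 1
  | load _ i => i.cost + 1
  | add e₁ e₂ => e₁.cost + e₂.cost + 1
  | sub e₁ e₂ => e₁.cost + e₂.cost + 1
  | mul e₁ e₂ => e₁.cost + e₂.cost + 1
  | div e₁ e₂ => e₁.cost + e₂.cost + 1

end RExp

/-- Tests: comparisons of integers and of reals, negation and conjunction. -/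
inductive BExp where
  | ile (e₁ e₂ : IExp)
  | rle (e₁ e₂ : RExp)
  | not (b : BExp)
  | and (b₁ b₂ : BExp)

namespace BExp

def Holds (s : State) : BExp → Prop
  | ile e₁ e₂ => e₁.val s ≤ e₂.val s
  | rle e₁ e₂ => e₁.val s ≤ e₂.val s
  | not b => ¬ b.Holds s
  | and b₁ b₂ => b₁.Holds s ∧ b₂.Holds s

def Safe (W : ℕ) (s : State) : BExp → Prop
  | ile e₁ e₂ => e₁.Safe W s ∧ e₂.Safe W s
  | rle e₁ e₂ => e₁.Safe W s ∧ e₂.Safe W s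
  | not b => b.Safe W s
  | and b₁ b₂ => b₁.Safe W s ∧ b₂.Safe W s

def cost : BExp → ℕ
  | ile e₁ e₂ => e₁.cost + e₂.cost + 1
  | rle e₁ e₂ => e₁.cost + e₂.cost + 1
  | not b => b.cost + 1
  | and b₁ b₂ => b₁.cost + b₂.cost + 1

end BExp

/-- Programs: `x := e` and `a[i] := e` for integers and reals, sequence, branching, while loop. -/
inductive Prog where
  | skip
  | iset (x : ℕ) (e : IExp)
  | rset (x : ℕ) (e : RExp)
  | istore (a : ℕ) (i e : IExp)
  | rstore (a : ℕ) (i : IExp) (e : RExp)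
  | seq (p q : Prog)
  | ite (b : BExp) (p q : Prog)
  | loop (b : BExp) (p : Prog)

/-- `Exec W p s t s'`: with word bound `W`, the program `p` started in the memory `s`
halts after exactly `t` steps with the memory `s'`. -/
inductive Exec (W : ℕ) : Prog → State → ℕ → State → Prop
  | skip (s : State) : Exec W .skip s 1 s
  | iset (x : ℕ) (e : IExp) (s : State) (he : e.Safe W s) :
      Exec W (.iset x e) s (e.cost + 1)
        { s with ivar := Function.update s.ivar x (e.val s) }
  | rset (x : ℕ) (e : RExp) (s : State) (he : e.Safe W s) :
      Exec W (.rset x e) s (e.cost + 1)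
        { s with rvar := Function.update s.rvar x (e.val s) }
  | istore (a : ℕ) (i e : IExp) (s : State) (hi : i.Safe W s) (he : e.Safe W s) :
      Exec W (.istore a i e) s (i.cost + e.cost + 1)
        { s with iarr := Function.update s.iarr a
                  (Function.update (s.iarr a) (i.val s) (e.val s)) }
  | rstore (a : ℕ) (i : IExp) (e : RExp) (s : State) (hi : i.Safe W s) (he : e.Safe W s) :
      Exec W (.rstore a i e) s (i.cost + e.cost + 1)
        { s with rarr := Function.update s.rarr a
                  (Function.update (s.rarr a) (i.val s) (e.val s)) }
  | seq {p q : Prog} {s s' s'' : State} {t t' : ℕ}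
      (hp : Exec W p s t s') (hq : Exec W q s' t' s'') :
      Exec W (.seq p q) s (t + t') s''
  | ite_true {b : BExp} {p q : Prog} {s s' : State} {t : ℕ}
      (hs : b.Safe W s) (hb : b.Holds s) (hp : Exec W p s t s') :
      Exec W (.ite b p q) s (b.cost + 1 + t) s'
  | ite_false {b : BExp} {p q : Prog} {s s' : State} {t : ℕ}
      (hs : b.Safe W s) (hb : ¬ b.Holds s) (hq : Exec W q s t s') :
      Exec W (.ite b p q) s (b.cost + 1 + t) s'
  | loop_true {b : BExp} {p : Prog} {s s' s'' : State} {t t' : ℕ}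
      (hs : b.Safe W s) (hb : b.Holds s) (hp : Exec W p s t s')
      (hl : Exec W (.loop b p) s' t' s'') :
      Exec W (.loop b p) s (b.cost + 1 + t + t') s''
  | loop_false {b : BExp} {p : Prog} {s : State}
      (hs : b.Safe W s) (hb : ¬ b.Holds s) :
      Exec W (.loop b p) s (b.cost + 1) s

/-- The initial memory: the integer variable `0` holds `n`, the real variable `0` holds `ε`, the
real array `0` holds the entries of `A` row by row, and everything else is `0`. -/
noncomputable def input {n : ℕ} (ε : ℝ) (A : Matrix (Fin n) (Fin n) ℝ) : State where
  ivar x := if x = 0 then n else 0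
  rvar x := if x = 0 then ε else 0
  iarr _ _ := 0
  rarr a k := if h : a = 0 ∧ k < n * n then
      A ⟨k / n, Nat.div_lt_of_lt_mul h.2⟩
        ⟨k % n, Nat.mod_lt _ (Nat.pos_of_mul_pos_right (Nat.zero_lt_of_lt h.2))⟩
    else 0

/-- The final memory `s` represents the output `r`, `S`, `T`, `c`: the integer variable `1` holds
`r`, the integer arrays `0` and `1` hold, row by row, the `r × n` tables of the 0/1 incidence
vectors of the sets `S l` and `T l`, and the real array `1` holds the numbers `c l`. -/
def Outputs (s : State) {n r : ℕ} (S T : Fin r → Finset (Fin n)) (c : Fin r → ℝ) : Prop :=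
  s.ivar 1 = r ∧
  (∀ (l : Fin r) (i : Fin n), s.iarr 0 (l * n + i) = if i ∈ S l then 1 else 0) ∧
  (∀ (l : Fin r) (i : Fin n), s.iarr 1 (l * n + i) = if i ∈ T l then 1 else 0) ∧
  (∀ l : Fin r, s.rarr 1 l = c l)

end RealRAM

/-- The characteristic vector of a set of indices. -/
def charVec {n : ℕ} (S : Finset (Fin n)) : Fin n → ℝ := fun i => if i ∈ S then 1 else 0

/-- The sum of the cut matrices `c l • 1_{S l} 1_{T l}ᵀ`. -/
noncomputable def cutSum {n r : ℕ} (S T : Fin r → Finset (Fin n)) (c : Fin r → ℝ) :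
    Matrix (Fin n) (Fin n) ℝ :=
  ∑ l, c l • Matrix.vecMulVec (charVec (S l)) (charVec (T l))

/-- The spectral norm of a real square matrix: its operator norm with respect to the Euclidean
norm. -/
noncomputable def specNorm {n : ℕ} (M : Matrix (Fin n) (Fin n) ℝ) : ℝ :=
  ‖Matrix.toEuclideanCLM (n := Fin n) (𝕜 := ℝ) M‖

namespace RealRAM

open Finset

-- Let `D` be the current residual, with rows `a_i`, and let `c = ε ^ 8 / 300`. The argument is
-- energy decrement with a deterministic search for cuts.
--
-- Decrement. Since `(d - σ c)² = d² - 2 c (σ d - c / 2)` for a sign `σ`, subtracting `σ c` from an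
-- entry lowers its square by `2 c` times its gain `σ d - c / 2`. A cut of signed weight at least `c
-- n²` has total gain at least `c n² / 2`. Deleting a row or column of the cut whose gains have a
-- negative sum only raises the total. Once none is left, no row or column square sum grows on
-- subtraction (`Bounded.update`), and the energy, initially at most `n²`, falls by at least `c²
-- n²`. So there are at most `1 / c² = 90000 ε⁻¹ ^ 16` cuts.
--
-- Existence of a cut. If `‖D‖ > ε n`, then `DᵀD = ∑ a_i ⊗ a_i` has Frobenius norm above `ε² n²`, so
-- on average over the rows `‖D a_i‖² = ⟨a_i ⊗ a_i, DᵀD⟩` is of order `ε⁴ n³`. From such a row, the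
-- sign pattern of `Dᵀ D a_i` gives the columns `T` of a heavy cut, and the sign pattern of `D 1_T`
-- gives its rows (`exists_le_candV`).
--
-- Sampling. Testing a row costs order `n²` steps, so only a sample of `B²` rows can be tried, where
-- `B` is the least positive integer with `32 ≤ B ε²`. A list that repeats all rows cyclically is
-- shortened by a factor of 16 per level. From every group of 16 the element is kept that correlates
-- least with the error made so far in its block. The new error then has nonpositive inner product
-- with the old one, so inside a block squared norms add as for independent errors. The vectors `a_i
-- ⊗ a_i` are never formed, because their inner products are `⟨a_i, a_j⟩²`. With blocks growing by 4
-- while the list shrinks by 16, the costs of the levels decrease geometrically, and the errors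
-- remain summable (`Reach.norm_le`). If no sampled row yields a heavy cut, the residual has small
-- norm (`smallNorm_of_candV_lt`).

infixr:60 "⨟" => Prog.seq

/-! ### Memory updates, and the part of the memory that a program can change. -/

namespace State

def setI (s : State) (x v : ℕ) : State := { s with ivar := Function.update s.ivar x v }
def setR (s : State) (x : ℕ) (v : ℝ) : State := { s with rvar := Function.update s.rvar x v }
def putI (s : State) (a i v : ℕ) : State :=
  { s with iarr := Function.update s.iarr a (Function.update (s.iarr a) i v) }
def putR (s : State) (a i : ℕ) (v : ℝ) : State :=
  { s with rarr := Function.update s.rarr a (Function.update (s.rarr a) i v) }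

variable (s : State) (x y a a' i v : ℕ) (z : ℝ)

@[simp] theorem setI_ivar : (s.setI x v).ivar y = if y = x then v else s.ivar y :=
  Function.update_apply ..
@[simp] theorem setI_rvar : (s.setI x v).rvar = s.rvar := rfl
@[simp] theorem setI_iarr : (s.setI x v).iarr = s.iarr := rfl
@[simp] theorem setI_rarr : (s.setI x v).rarr = s.rarr := rfl
@[simp] theorem setR_rvar : (s.setR x z).rvar y = if y = x then z else s.rvar y :=
  Function.update_apply ..
@[simp] theorem setR_ivar : (s.setR x z).ivar = s.ivar := rfl
@[simp] theorem setR_iarr : (s.setR x z).iarr = s.iarr := rfl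
@[simp] theorem setR_rarr : (s.setR x z).rarr = s.rarr := rfl
@[simp] theorem putI_iarr : (s.putI a i v).iarr a' =
    if a' = a then Function.update (s.iarr a) i v else s.iarr a' :=
  Function.update_apply ..
@[simp] theorem putI_ivar : (s.putI a i v).ivar = s.ivar := rfl
@[simp] theorem putI_rvar : (s.putI a i v).rvar = s.rvar := rfl
@[simp] theorem putI_rarr : (s.putI a i v).rarr = s.rarr := rfl
@[simp] theorem putR_rarr : (s.putR a i z).rarr a' =
    if a' = a then Function.update (s.rarr a) i z else s.rarr a' :=
  Function.update_apply ..
@[simp] theorem putR_ivar : (s.putR a i z).ivar = s.ivar := rfl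
@[simp] theorem putR_rvar : (s.putR a i z).rvar = s.rvar := rfl
@[simp] theorem putR_iarr : (s.putR a i z).iarr = s.iarr := rfl

end State

attribute [simp] IExp.val IExp.Safe IExp.cost RExp.val RExp.Safe RExp.cost BExp.Holds BExp.Safe
  BExp.cost

/-- The integer variables that a program writes. -/
def Prog.wI : Prog → List ℕ
  | .iset x _ => [x]
  | .seq p q => p.wI ++ q.wI
  | .ite _ p q => p.wI ++ q.wI
  | .loop _ p => p.wI
  | _ => []

/-- The real variables that a program writes. -/
def Prog.wR : Prog → List ℕ
  | .rset x _ => [x]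
  | .seq p q => p.wR ++ q.wR
  | .ite _ p q => p.wR ++ q.wR
  | .loop _ p => p.wR
  | _ => []

/-- The integer arrays that a program writes. -/
def Prog.wIA : Prog → List ℕ
  | .istore a _ _ => [a]
  | .seq p q => p.wIA ++ q.wIA
  | .ite _ p q => p.wIA ++ q.wIA
  | .loop _ p => p.wIA
  | _ => []

/-- The real arrays that a program writes. -/
def Prog.wRA : Prog → List ℕ
  | .rstore a _ _ => [a]
  | .seq p q => p.wRA ++ q.wRA
  | .ite _ p q => p.wRA ++ q.wRA
  | .loop _ p => p.wRA
  | _ => []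

/-- The two memories agree on everything that the program does not write. -/
structure Agree (p : Prog) (s s' : State) : Prop where
  ivar : ∀ x, x ∉ p.wI → s'.ivar x = s.ivar x
  rvar : ∀ x, x ∉ p.wR → s'.rvar x = s.rvar x
  iarr : ∀ x, x ∉ p.wIA → s'.iarr x = s.iarr x
  rarr : ∀ x, x ∉ p.wRA → s'.rarr x = s.rarr x

namespace Agree

theorem refl (p : Prog) (s : State) : Agree p s s :=
  ⟨fun _ _ => rfl, fun _ _ => rfl, fun _ _ => rfl, fun _ _ => rfl⟩

theorem trans {p : Prog} {s s' s'' : State} (h : Agree p s s') (h' : Agree p s' s'') :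
    Agree p s s'' :=
  ⟨fun x hx => (h'.ivar x hx).trans (h.ivar x hx), fun x hx => (h'.rvar x hx).trans (h.rvar x hx),
    fun x hx => (h'.iarr x hx).trans (h.iarr x hx), fun x hx => (h'.rarr x hx).trans (h.rarr x hx)⟩

theorem mono {p q : Prog} {s s' : State} (h : Agree p s s') (hI : p.wI ⊆ q.wI) (hR : p.wR ⊆ q.wR)
    (hIA : p.wIA ⊆ q.wIA) (hRA : p.wRA ⊆ q.wRA) : Agree q s s' :=
  ⟨fun x hx => h.ivar x fun h => hx (hI h), fun x hx => h.rvar x fun h => hx (hR h),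
    fun x hx => h.iarr x fun h => hx (hIA h), fun x hx => h.rarr x fun h => hx (hRA h)⟩

end Agree

/-- The frame rule. The written names are computed from the syntax, so that a variable or array is
untouched can be settled by `decide`. -/
theorem Exec.agree {W : ℕ} {p : Prog} {s s' : State} {t : ℕ} (h : Exec W p s t s') :
    Agree p s s' := by
  induction h with
  | skip s => exact .refl _ _
  | iset x e s he =>
    refine ⟨fun y hy => ?_, fun _ _ => rfl, fun _ _ => rfl, fun _ _ => rfl⟩
    simp only [Prog.wI, List.mem_singleton] at hy
    simp [hy]
  | rset x e s he =>
    refine ⟨fun _ _ => rfl, fun y hy => ?_, fun _ _ => rfl, fun _ _ => rfl⟩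
    simp only [Prog.wR, List.mem_singleton] at hy
    simp [hy]
  | istore a i e s hi he =>
    refine ⟨fun _ _ => rfl, fun _ _ => rfl, fun y hy => ?_, fun _ _ => rfl⟩
    simp only [Prog.wIA, List.mem_singleton] at hy
    simp [hy]
  | rstore a i e s hi he =>
    refine ⟨fun _ _ => rfl, fun _ _ => rfl, fun _ _ => rfl, fun y hy => ?_⟩
    simp only [Prog.wRA, List.mem_singleton] at hy
    simp [hy]
  | seq hp hq ihp ihq =>
    exact (ihp.mono (q := .seq _ _) (List.subset_append_left _ _) (List.subset_append_left _ _)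
        (List.subset_append_left _ _) (List.subset_append_left _ _)).trans
      (ihq.mono (List.subset_append_right _ _) (List.subset_append_right _ _)
        (List.subset_append_right _ _) (List.subset_append_right _ _))
  | ite_true _ _ _ ih =>
    exact ih.mono (List.subset_append_left _ _) (List.subset_append_left _ _)
        (List.subset_append_left _ _) (List.subset_append_left _ _)
  | ite_false _ _ _ ih =>
    exact ih.mono (List.subset_append_right _ _) (List.subset_append_right _ _)
        (List.subset_append_right _ _) (List.subset_append_right _ _)
  | loop_true _ _ _ _ ihp ihl =>
    exact (ihp.mono (q := .loop _ _) (List.Subset.refl _) (List.Subset.refl _) (List.Subset.refl _)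
      (List.Subset.refl _)).trans ihl
  | loop_false _ _ => exact .refl _ _

/-! ### Total correctness rules with time bounds. -/

/-- The program halts within `T` steps in a memory that satisfies `Q`. -/
def Runs (W : ℕ) (p : Prog) (s : State) (T : ℕ) (Q : State → Prop) : Prop :=
  ∃ t s', Exec W p s t s' ∧ t ≤ T ∧ Q s'

namespace Runs

variable {W : ℕ} {p q : Prog} {s : State} {T T' : ℕ} {Q R : State → Prop}

theorem frame (h : Runs W p s T Q) : Runs W p s T (fun s' => Q s' ∧ Agree p s s') :=
  let ⟨t, s', he, ht, hq⟩ := h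
  ⟨t, s', he, ht, hq, he.agree⟩

theorem mono (h : Runs W p s T Q) (hT : T ≤ T') (hQ : ∀ s', Q s' → Agree p s s' → R s') :
    Runs W p s T' R :=
  let ⟨t, s', he, ht, hq⟩ := h
  ⟨t, s', he, ht.trans hT, hQ s' hq he.agree⟩

theorem time (h : Runs W p s T Q) (hT : T ≤ T') : Runs W p s T' Q :=
  h.mono hT fun _ h _ => h

theorem seq (h : Runs W p s T R) (h' : ∀ s', R s' → Agree p s s' → Runs W q s' T' Q) :
    Runs W (p ⨟ q) s (T + T') Q := by
  obtain ⟨t, s', he, ht, hq⟩ := h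
  obtain ⟨t', s'', he', ht', hq'⟩ := h' s' hq he.agree
  exact ⟨t + t', s'', .seq he he', add_le_add ht ht', hq'⟩

theorem skip (h : Q s) : Runs W .skip s 1 Q := ⟨_, _, .skip s, le_rfl, h⟩

theorem iset {x : ℕ} {e : IExp} (he : e.Safe W s) (h : Q (s.setI x (e.val s))) :
    Runs W (.iset x e) s (e.cost + 1) Q := ⟨_, _, .iset x e s he, le_rfl, h⟩

theorem rset {x : ℕ} {e : RExp} (he : e.Safe W s) (h : Q (s.setR x (e.val s))) :
    Runs W (.rset x e) s (e.cost + 1) Q := ⟨_, _, .rset x e s he, le_rfl, h⟩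

theorem istore {a : ℕ} {i e : IExp} (hi : i.Safe W s) (he : e.Safe W s)
    (h : Q (s.putI a (i.val s) (e.val s))) :
    Runs W (.istore a i e) s (i.cost + e.cost + 1) Q := ⟨_, _, .istore a i e s hi he, le_rfl, h⟩

theorem rstore {a : ℕ} {i : IExp} {e : RExp} (hi : i.Safe W s) (he : e.Safe W s)
    (h : Q (s.putR a (i.val s) (e.val s))) :
    Runs W (.rstore a i e) s (i.cost + e.cost + 1) Q := ⟨_, _, .rstore a i e s hi he, le_rfl, h⟩

theorem iset_seq {x : ℕ} {e : IExp} (he : e.Safe W s)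
    (h : Runs W q (s.setI x (e.val s)) T Q) :
    Runs W (.iset x e ⨟ q) s (e.cost + 1 + T) Q :=
  (iset (Q := fun s' => s' = s.setI x (e.val s)) he rfl).seq (by rintro _ rfl _; exact h)

theorem rset_seq {x : ℕ} {e : RExp} (he : e.Safe W s)
    (h : Runs W q (s.setR x (e.val s)) T Q) :
    Runs W (.rset x e ⨟ q) s (e.cost + 1 + T) Q :=
  (rset (Q := fun s' => s' = s.setR x (e.val s)) he rfl).seq (by rintro _ rfl _; exact h)

theorem istore_seq {a : ℕ} {i e : IExp} (hi : i.Safe W s) (he : e.Safe W s)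
    (h : Runs W q (s.putI a (i.val s) (e.val s)) T Q) :
    Runs W (.istore a i e ⨟ q) s (i.cost + e.cost + 1 + T) Q :=
  (istore (Q := fun s' => s' = s.putI a (i.val s) (e.val s)) hi he rfl).seq
    (by rintro _ rfl _; exact h)

theorem rstore_seq {a : ℕ} {i : IExp} {e : RExp} (hi : i.Safe W s) (he : e.Safe W s)
    (h : Runs W q (s.putR a (i.val s) (e.val s)) T Q) :
    Runs W (.rstore a i e ⨟ q) s (i.cost + e.cost + 1 + T) Q :=
  (rstore (Q := fun s' => s' = s.putR a (i.val s) (e.val s)) hi he rfl).seq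
    (by rintro _ rfl _; exact h)

theorem ite {b : BExp} (hs : b.Safe W s) (h₁ : b.Holds s → Runs W p s T Q)
    (h₂ : ¬ b.Holds s → Runs W q s T Q) : Runs W (.ite b p q) s (b.cost + 1 + T) Q := by
  by_cases hb : b.Holds s
  · obtain ⟨t, s', he, ht, hq⟩ := h₁ hb
    exact ⟨_, s', .ite_true hs hb he, by omega, hq⟩
  · obtain ⟨t, s', he, ht, hq⟩ := h₂ hb
    exact ⟨_, s', .ite_false hs hb he, by omega, hq⟩

theorem ite_max {b : BExp} (hs : b.Safe W s) (h₁ : b.Holds s → Runs W p s T Q)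
    (h₂ : ¬ b.Holds s → Runs W q s T' Q) :
    Runs W (.ite b p q) s (b.cost + 1 + max T T') Q :=
  ite hs (fun h => (h₁ h).time (le_max_left _ _)) fun h => (h₂ h).time (le_max_right _ _)

/-- A loop with a time budget `τ`, which also proves that it terminates. -/
theorem loop {b : BExp} (I : ℕ → State → Prop)
    (h : ∀ τ s, I τ s → b.Safe W s ∧ (¬ b.Holds s → Q s ∧ b.cost + 1 ≤ τ) ∧
      (b.Holds s → ∃ T, Runs W p s T fun s' => ∃ τ', I τ' s' ∧ b.cost + 1 + T + τ' ≤ τ))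
    {τ : ℕ} {s : State} (hI : I τ s) : Runs W (.loop b p) s τ Q := by
  -- Every iteration pays at least for its test, so the budget decreases strictly.
  induction τ using Nat.strong_induction_on generalizing s with
  | _ τ ih =>
    obtain ⟨hs, hf, ht⟩ := h τ s hI
    by_cases hb : b.Holds s
    · obtain ⟨T, t, s', he, htT, τ', hI', hle⟩ := ht hb
      obtain ⟨t', s'', he', ht', hq⟩ := ih τ' (by omega) hI'
      exact ⟨_, s'', .loop_true hs hb he he', by omega, hq⟩
    · exact ⟨_, s, .loop_false hs hb, (hf hb).2, (hf hb).1⟩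

end Runs

/-- `for i < e do p`. -/
def Prog.forTo (i : ℕ) (e : IExp) (p : Prog) : Prog :=
  .iset i (.lit 0) ⨟ .loop (.not (.ile e (.var i))) (p ⨟ .iset i (.add (.var i) (.lit 1)))

/-- The limit `e` is evaluated anew before each iteration, hence `hlim` for all memories that agree
with the initial one outside the loop's writes. The invariant refers to the memory after the counter
has been set. -/
theorem Runs.forTo {W i N T : ℕ} {e : IExp} {p : Prog} {s : State} {Q : State → Prop}
    (I : ℕ → State → Prop)
    (hlim : ∀ s', Agree (.forTo i e p) s s' → e.Safe W s' ∧ e.val s' = N)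
    (hN : N ≤ W) (hi : i ∉ p.wI) (h0 : I 0 (s.setI i 0))
    (hstep : ∀ k s', k < N → Agree (.forTo i e p) s s' → s'.ivar i = k → I k s' →
      Runs W p s' T fun s'' => I (k + 1) (s''.setI i (k + 1)))
    (hQ : ∀ s', I N s' → Agree (.forTo i e p) s s' → Q s') :
    Runs W (.forTo i e p) s (N * (T + e.cost + 8) + e.cost + 6) Q := by
  suffices h : Runs W (.forTo i e p) s (N * (T + e.cost + 8) + e.cost + 6) (I N) from
    h.mono le_rfl hQ
  have h0' : Agree (.forTo i e p) s (s.setI i 0) := by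
    refine ⟨fun y hy => ?_, fun _ _ => rfl, fun _ _ => rfl, fun _ _ => rfl⟩
    have : y ≠ i := by
      rintro rfl; exact hy (by simp [Prog.forTo, Prog.wI])
    simp [this]
  refine (Runs.iset_seq (T := N * (T + e.cost + 8) + e.cost + 4) (by simp) ?_).time
    (by simp; omega)
  refine Runs.loop (fun τ s' => ∃ k ≤ N, Agree (.forTo i e p) s s' ∧ s'.ivar i = k ∧ I k s' ∧
    (N - k) * (T + e.cost + 8) + e.cost + 4 ≤ τ) ?_
    ⟨0, Nat.zero_le _, h0', by simp, h0, by simp⟩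
  rintro τ s' ⟨k, hk, hA, hik, hI, hτ⟩
  obtain ⟨hs, hv⟩ := hlim s' hA
  refine ⟨⟨hs, trivial⟩, fun hb => ?_, fun hb => ?_⟩
  · simp only [BExp.Holds, IExp.val, not_not, hv, hik] at hb
    obtain rfl : k = N := le_antisymm hk hb
    exact ⟨hI, by simp; omega⟩
  · simp only [BExp.Holds, IExp.val, hv, hik, not_le] at hb
    refine ⟨T + 4, ?_⟩
    refine (hstep k s' hb hA hik hI).frame.seq fun s₁ ⟨h₁, hA₁⟩ _ => ?_
    have hik₁ : s₁.ivar i = k := by rw [hA₁.ivar i hi, hik]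
    refine Runs.iset ?_ ?_
    · simp [hik₁]; omega
    · have e1 : (IExp.add (.var i) (.lit 1)).val s₁ = k + 1 := by simp [hik₁]
      rw [e1]
      refine ⟨(N - (k + 1)) * (T + e.cost + 8) + e.cost + 4,
        ⟨k + 1, hb, ?_, by simp, h₁, le_rfl⟩, ?_⟩
      · refine hA.trans ⟨fun y hy => ?_, fun y hy => ?_, fun y hy => ?_, fun y hy => ?_⟩
        · simp only [Prog.forTo, Prog.wI, List.mem_append, List.mem_singleton, not_or] at hy
          simp [hy.1, hA₁.ivar y hy.2.1]
        · simp only [Prog.forTo, Prog.wR, List.mem_append, not_or] at hy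
          simp [hA₁.rvar y hy.2.1]
        · simp only [Prog.forTo, Prog.wIA, List.mem_append, not_or] at hy
          simp [hA₁.iarr y hy.2.1]
        · simp only [Prog.forTo, Prog.wRA, List.mem_append, not_or] at hy
          simp [hA₁.rarr y hy.2.1]
      · obtain ⟨m, rfl⟩ : ∃ m, N = k + 1 + m := ⟨N - (k + 1), by omega⟩
        have h1 : k + 1 + m - k = m + 1 := by omega
        have h2 : k + 1 + m - (k + 1) = m := by omega
        rw [h1, add_mul] at hτ
        rw [h2]
        simp only [BExp.cost, IExp.cost]
        omega

/-! ### Greedy choice of one element from each group of 16. -/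

/-- The inner product of the rows `x` and `y` of a matrix that is stored row by row. -/
def rowDot (d : ℕ → ℝ) (n x y : ℕ) : ℝ := ∑ j ∈ range n, d (x * n + j) * d (y * n + j)

/-- The address of the entry in row `x`, column `y`, for integer variables `x`, `y`. -/
abbrev adr (x y : ℕ) : IExp := .add (.mul (.var x) (.var 0)) (.var y)

theorem adr_lt {n k j : ℕ} (hk : k < n) (hj : j < n) : k * n + j < n * n := by
  nlinarith

/-- `r₁₀ := ⟨row i₂₀, row i₂₁⟩`. -/
def kern : Prog :=
  .rset 10 (.ofNat (.lit 0)) ⨟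
  .forTo 22 (.var 0) (.rset 10 (.add (.var 10) (.mul (.load 0 (adr 20 22)) (.load 0 (adr 21 22)))))

theorem runs_kern {W n x y : ℕ} {s : State} (hn : s.ivar 0 = n) (hx : s.ivar 20 = x)
    (hy : s.ivar 21 = y) (hxn : x < n) (hyn : y < n) (hW : n * n ≤ W) :
    Runs W kern s (40 * n + 20) fun s' => s'.rvar 10 = rowDot (s.rarr 0) n x y := by
  have hnn : n ≤ n * n := Nat.le_mul_self n
  unfold kern
  apply Runs.time
  · apply Runs.rset_seq (by simp)
    apply Runs.forTo (N := n) (I := fun k s' => s'.rvar 10 =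
      ∑ j ∈ range k, s.rarr 0 (x * n + j) * s.rarr 0 (y * n + j)) (hN := by omega) (hi := by decide)
    · intro s' hA
      simp [hA.ivar 0 (by decide), hn]
    · simp
    · intro k s' hk hA hi hI
      have h0 := hA.ivar 0 (by decide)
      have h20 := hA.ivar 20 (by decide)
      have h21 := hA.ivar 21 (by decide)
      have hd := hA.rarr 0 (by decide)
      simp only [State.setR_ivar, State.setR_rarr, hn, hx, hy] at h0 h20 h21 hd
      have := adr_lt hxn hk
      have := adr_lt hyn hk
      apply Runs.rset
      · simp [h0, h20, h21, hi]; omega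
      · simp [h0, h20, h21, hi, hd, sum_range_succ, hI]
    · exact fun s' h _ => h
  · simp; omega

/-- The squared inner product of two rows. -/
def rowKer (d : ℕ → ℝ) (n y x : ℕ) : ℝ := rowDot d n x y * rowDot d n x y

/-- The correlation of the element `x` with the error that the choices `L' q` from the groups
`L (16 q), …, L (16 q + 15)` with `q₀ ≤ q < q₀ + k` have caused. -/
def score (K : ℕ → ℕ → ℝ) (L L' : ℕ → ℕ) (q₀ k x : ℕ) : ℝ :=
  ∑ q ∈ range k, ∑ c ∈ range 16, (K (L' (q₀ + q)) x - K (L (16 * (q₀ + q) + c)) x)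

theorem score_succ (K : ℕ → ℕ → ℝ) (L L' : ℕ → ℕ) (q₀ k x : ℕ) :
    score K L L' q₀ (k + 1) x = score K L L' q₀ k x +
      ∑ c ∈ range 16, (K (L' (q₀ + k)) x - K (L (16 * (q₀ + k) + c)) x) :=
  sum_range_succ _ _

/-- `r₁₁ := score` of the element `i₂₀` in the block from `i₂₄` to `i₂₃`. -/
def scoreProg : Prog :=
  .rset 11 (.ofNat (.lit 0)) ⨟
  .forTo 26 (.sub (.var 23) (.var 24)) (
    .iset 28 (.add (.var 24) (.var 26)) ⨟
    .forTo 27 (.lit 16) (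
      .iset 21 (.load 3 (.var 28)) ⨟ kern ⨟
      .rset 11 (.add (.var 11) (.mul (.var 10) (.var 10))) ⨟
      .iset 21 (.load 2 (.add (.mul (.lit 16) (.var 28)) (.var 27))) ⨟ kern ⨟
      .rset 11 (.sub (.var 11) (.mul (.var 10) (.var 10)))))

/-- Each earlier choice in the block costs 32 inner products of length `n`. The factor `p - q₀` is
the reason for cutting the list into blocks. -/
theorem runs_score {W n x p q₀ : ℕ} {s : State} (hn : s.ivar 0 = n) (hx : s.ivar 20 = x)
    (hp : s.ivar 23 = p) (hq : s.ivar 24 = q₀) (hxn : x < n)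
    (hL' : ∀ q < p, s.iarr 3 q < n) (hL : ∀ i < 16 * p, s.iarr 2 i < n)
    (hW : n * n ≤ W) (hpW : 16 * p ≤ W) :
    Runs W scoreProg s ((p - q₀) * (5000 * n) + 20) fun s' =>
      s'.rvar 11 = score (rowKer (s.rarr 0) n) (s.iarr 2) (s.iarr 3) q₀ (p - q₀) x := by
  unfold scoreProg
  apply Runs.time
  · apply Runs.rset_seq (by simp)
    apply Runs.forTo (N := p - q₀) (I := fun k s' => s'.rvar 11 =
      score (rowKer (s.rarr 0) n) (s.iarr 2) (s.iarr 3) q₀ k x) (hN := by omega) (hi := by decide)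
    · intro s' hA
      have h23 := hA.ivar 23 (by decide)
      have h24 := hA.ivar 24 (by decide)
      simp only [State.setR_ivar, hp, hq] at h23 h24
      simp [h23, h24]
    · simp [score]
    · intro k s' hk hA hi hI
      have h0 := hA.ivar 0 (by decide)
      have h20 := hA.ivar 20 (by decide)
      have h24 := hA.ivar 24 (by decide)
      have hd := hA.rarr 0 (by decide)
      have hl := hA.iarr 2 (by decide)
      have hl' := hA.iarr 3 (by decide)
      simp only [State.setR_ivar, State.setR_rarr, State.setR_iarr, hn, hx, hq]
        at h0 h20 h24 hd hl hl'
      apply Runs.iset_seq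
      · simp [h24, hi]; omega
      apply Runs.forTo (N := 16) (I := fun c s'' => s''.rvar 11 =
        score (rowKer (s.rarr 0) n) (s.iarr 2) (s.iarr 3) q₀ k x +
        ∑ c ∈ range c, (rowKer (s.rarr 0) n (s.iarr 3 (q₀ + k)) x -
          rowKer (s.rarr 0) n (s.iarr 2 (16 * (q₀ + k) + c)) x)) (hN := by omega) (hi := by decide)
      · intro s'' _
        simp; omega
      · simp [hI]
      · intro c s₁ hc hA₁ hi₁ hI₁
        have g0 := hA₁.ivar 0 (by decide)
        have g20 := hA₁.ivar 20 (by decide)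
        have g28 := hA₁.ivar 28 (by decide)
        have gd := hA₁.rarr 0 (by decide)
        have gl := hA₁.iarr 2 (by decide)
        have gl' := hA₁.iarr 3 (by decide)
        simp [h0, h20, h24, hi, hd, hl, hl'] at g0 g20 g28 gd gl gl'
        apply Runs.iset_seq
        · simp
        apply Runs.seq
        · exact runs_kern (n := n) (x := x) (y := s.iarr 3 (q₀ + k)) (by simp [g0]) (by simp [g20])
            (by simp [gl', g28]) hxn (hL' _ (by omega)) hW
        intro s₂ hK₂ hA₂
        have f0 := hA₂.ivar 0 (by decide)
        have f20 := hA₂.ivar 20 (by decide)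
        have f28 := hA₂.ivar 28 (by decide)
        have f27 := hA₂.ivar 27 (by decide)
        have f11 := hA₂.rvar 11 (by decide)
        have fd := hA₂.rarr 0 (by decide)
        have fl := hA₂.iarr 2 (by decide)
        simp [g0, g20, g28, gd, gl, hi₁] at f0 f20 f28 f27 f11 fd fl
        apply Runs.rset_seq (by simp)
        apply Runs.iset_seq
        · simp [f28, f27]; omega
        apply Runs.seq
        · exact runs_kern (n := n) (x := x) (y := s.iarr 2 (16 * (q₀ + k) + c)) (by simp [f0])
            (by simp [f20]) (by simp [fl, f28, f27]) hxn (hL _ (by omega)) hW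
        intro s₃ hK₃ hA₃
        have e11 := hA₃.rvar 11 (by decide)
        simp at e11
        apply Runs.rset (by simp)
        simp only [State.setI_rarr, State.setR_rarr, gd, fd] at hK₂ hK₃
        simp [e11, f11, hI₁, hK₂, hK₃, sum_range_succ, rowKer]
        ring
      · intro s₁ hI₁ _
        rw [State.setI_rvar, hI₁, score_succ]
    · exact fun s' h _ => h
  · simp
    refine le_trans (b := 3 + ((p - q₀) * (5000 * n) + 3 + 6)) (by gcongr; omega) (by omega)

/-- Store in `a₃[i₂₃]` the element of the group `i₂₃` with the least score. -/
def pickProg : Prog :=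
  -- The start of the block that contains the group, with block length `i₅`.
  .iset 24 (.mul (.div (.var 23) (.var 5)) (.var 5)) ⨟
  .forTo 25 (.lit 16) (
    .iset 20 (.load 2 (.add (.mul (.lit 16) (.var 23)) (.var 25))) ⨟ scoreProg ⨟
    -- `r₁₂` is the least score so far; it is meaningless at the first element, which is always
    -- taken.
    .ite (.and (.not (.ile (.var 25) (.lit 0))) (.rle (.var 12) (.var 11))) .skip
      (.rset 12 (.var 11) ⨟ .istore 3 (.var 23) (.var 20)))

/-- A score depends only on the choices made before it, so writing later choices does not invalidate
earlier comparisons. -/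
theorem score_congr {K : ℕ → ℕ → ℝ} {L L' L'' : ℕ → ℕ} {q₀ k x : ℕ}
    (h : ∀ q < q₀ + k, L' q = L'' q) : score K L L' q₀ k x = score K L L'' q₀ k x :=
  sum_congr rfl fun q hq => by rw [h _ (by have := mem_range.1 hq; omega)]

theorem runs_pick {W n p b : ℕ} {s : State} (hn : s.ivar 0 = n)
    (hp : s.ivar 23 = p) (hb : s.ivar 5 = b) (hb0 : 0 < b) (hn0 : 0 < n)
    (hL' : ∀ q < p, s.iarr 3 q < n) (hL : ∀ i < 16 * (p + 1), s.iarr 2 i < n)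
    (hW : n * n ≤ W) (hpW : 16 * (p + 1) ≤ W) :
    Runs W pickProg s (b * (100000 * n)) fun s' =>
      (∀ q, q ≠ p → s'.iarr 3 q = s.iarr 3 q) ∧
      (∃ c < 16, s'.iarr 3 p = s.iarr 2 (16 * p + c)) ∧
      ∀ c < 16, score (rowKer (s.rarr 0) n) (s.iarr 2) (s.iarr 3) (p / b * b) (p - p / b * b)
          (s'.iarr 3 p) ≤
        score (rowKer (s.rarr 0) n) (s.iarr 2) (s.iarr 3) (p / b * b) (p - p / b * b)
          (s.iarr 2 (16 * p + c)) := by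
  have hdm := Nat.div_add_mod' p b
  have hmb := Nat.mod_lt p hb0
  unfold pickProg
  set sc := score (rowKer (s.rarr 0) n) (s.iarr 2) (s.iarr 3) (p / b * b) (p - p / b * b) with hsc
  apply Runs.time
  · apply Runs.iset_seq
    · simp [hb, hp]; omega
    apply Runs.forTo (N := 16) (hN := by omega) (hi := by decide)
      (I := fun c s' => (∀ q, q ≠ p → s'.iarr 3 q = s.iarr 3 q) ∧
        (0 < c → (∃ c₀ < c, s'.iarr 3 p = s.iarr 2 (16 * p + c₀)) ∧
          s'.rvar 12 = sc (s'.iarr 3 p) ∧ ∀ c₁ < c, s'.rvar 12 ≤ sc (s.iarr 2 (16 * p + c₁))))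
    · intro s' _
      simp; omega
    · simp
    · intro c s' hc hA hi ⟨hI, hI'⟩
      have h0 := hA.ivar 0 (by decide)
      have h23 := hA.ivar 23 (by decide)
      have h24 := hA.ivar 24 (by decide)
      have hd := hA.rarr 0 (by decide)
      have hl := hA.iarr 2 (by decide)
      simp [hn, hp, hb] at h0 h23 h24 hd hl
      apply Runs.iset_seq
      · simp [h23, hi]; omega
      apply Runs.seq
      · exact runs_score (n := n) (x := s.iarr 2 (16 * p + c)) (p := p) (q₀ := p / b * b)
          (by simp [h0]) (by simp [hl, h23, hi]) (by simp [h23]) (by simp [h24])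
          (hL _ (by omega)) (fun q hq => by simpa [hI q hq.ne] using hL' q hq)
          (fun i hi => by simpa [hl] using hL i (by omega)) hW (by omega)
      intro s₁ hS hA₁
      have g12 := hA₁.rvar 12 (by decide)
      have g25 := hA₁.ivar 25 (by decide)
      have g20 := hA₁.ivar 20 (by decide)
      have g23 := hA₁.ivar 23 (by decide)
      have gl' := hA₁.iarr 3 (by decide)
      simp [h23, hi, hl] at g12 g25 g20 g23 gl'
      have hS' : s₁.rvar 11 = sc (s.iarr 2 (16 * p + c)) := by
        rw [hS, hsc]
        simp only [State.setI_iarr, State.setI_rarr, hd, hl]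
        exact score_congr fun q hq => hI q (by omega)
      apply Runs.ite_max
      · simp
      · intro hb
        simp [g25, g12, hS'] at hb
        apply Runs.skip
        obtain ⟨⟨c₀, hc₀, e₀⟩, e₁, e₂⟩ := hI' (Nat.pos_of_ne_zero hb.1)
        simp only [State.setI_iarr, State.setI_rvar, gl', g12]
        refine ⟨hI, fun _ => ⟨⟨c₀, by omega, e₀⟩, e₁, fun c₁ hc₁ => ?_⟩⟩
        rcases Nat.lt_succ_iff_lt_or_eq.1 hc₁ with h | rfl
        · exact e₂ _ h
        · exact hb.2
      · intro hb
        simp [g25, g12, hS'] at hb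
        apply Runs.rset_seq (by simp)
        apply Runs.istore (by simp) (by simp)
        simp only [State.setI_iarr, State.setI_rvar, gl', State.putI_iarr, State.setR_iarr,
          State.putI_rvar, State.setR_rvar, State.setR_ivar, RExp.val, IExp.val, g23, g20, hS', if_true]
        refine ⟨fun q hq => by simp [hq, hI], fun _ => ⟨⟨c, by omega, by simp⟩, by simp, 
          fun c₁ hc₁ => ?_⟩⟩
        rcases Nat.lt_succ_iff_lt_or_eq.1 hc₁ with h | rfl
        · exact (hb (by omega)).le.trans ((hI' (by omega)).2.2 _ h)
        · exact le_rfl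
    · rintro s' ⟨h, h'⟩ _
      obtain ⟨h₁, h₂, h₃⟩ := h' (by omega)
      exact ⟨h, h₁, fun c hc => h₂ ▸ h₃ c hc⟩
  · simp
    have h1 : (p - p / b * b) * (5000 * n) ≤ b * (5000 * n) := Nat.mul_le_mul_right _ (by omega)
    have h2 : 1 ≤ b * n := Nat.mul_pos hb0 hn0
    have e1 : b * (5000 * n) = 5000 * (b * n) := by ring
    have e2 : b * (100000 * n) = 100000 * (b * n) := by ring
    omega

/-- The choice `L' p` from the group `p` is one of its elements, and has the least score. -/
def PickOK (K : ℕ → ℕ → ℝ) (L L' : ℕ → ℕ) (b p : ℕ) : Prop :=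
  (∃ c < 16, L' p = L (16 * p + c)) ∧
  ∀ c < 16, score K L L' (p / b * b) (p - p / b * b) (L' p) ≤
    score K L L' (p / b * b) (p - p / b * b) (L (16 * p + c))

theorem PickOK.congr {K : ℕ → ℕ → ℝ} {L L' L'' : ℕ → ℕ} {b p : ℕ} (h : PickOK K L L' b p)
    (hL : ∀ q ≤ p, L'' q = L' q) : PickOK K L L'' b p := by
  have h1 : ∀ x, score K L L'' (p / b * b) (p - p / b * b) x =
      score K L L' (p / b * b) (p - p / b * b) x := fun x =>
    score_congr fun q hq => hL q (by have := Nat.div_mul_le_self p b; omega)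
  refine ⟨?_, fun c hc => ?_⟩
  · rw [hL p le_rfl]; exact h.1
  · rw [h1, h1, hL p le_rfl]; exact h.2 c hc

/-- Replace the list `a₂[0], …, a₂[i₄ - 1]` by one that is shorter by a factor of 16. -/
def levelProg : Prog :=
  .iset 6 (.div (.var 4) (.lit 16)) ⨟
  .forTo 23 (.var 6) pickProg ⨟
  -- The copy waits until all choices are made, because the scores still read the old list.
  .forTo 23 (.var 6) (.istore 2 (.var 23) (.load 3 (.var 23))) ⨟
  .iset 4 (.var 6) ⨟ .iset 5 (.mul (.lit 4) (.var 5))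

theorem runs_level {W n P b : ℕ} {s : State} (hn : s.ivar 0 = n) (hP : s.ivar 4 = 16 * P)
    (hb : s.ivar 5 = b) (hb0 : 0 < b) (hn0 : 0 < n) (hP0 : 0 < P)
    (hL : ∀ i < 16 * P, s.iarr 2 i < n) (hW : n * n ≤ W) (hPW : 16 * P ≤ W) (hbW : 4 * b ≤ W) :
    Runs W levelProg s (P * (b * (200000 * n))) fun s' =>
      s'.ivar 4 = P ∧ s'.ivar 5 = 4 * b ∧
      ∀ p < P, PickOK (rowKer (s.rarr 0) n) (s.iarr 2) (s'.iarr 2) b p := by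
  unfold levelProg
  apply Runs.time
  · apply Runs.iset_seq
    · simp; omega
    apply Runs.seq
    · apply Runs.forTo (N := P) (hN := by omega) (hi := by decide)
        (I := fun k s' => ∀ p < k, PickOK (rowKer (s.rarr 0) n) (s.iarr 2) (s'.iarr 3) b p)
        (Q := fun s' => ∀ p < P, PickOK (rowKer (s.rarr 0) n) (s.iarr 2) (s'.iarr 3) b p)
      · intro s' hA
        simp [hA.ivar 6 (by decide), hP]
      · simp
      · intro p s' hp hA hi hI
        have h0 := hA.ivar 0 (by decide)
        have h5 := hA.ivar 5 (by decide)
        have hd := hA.rarr 0 (by decide)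
        have hl := hA.iarr 2 (by decide)
        simp [hn, hb] at h0 h5 hd hl
        refine (runs_pick (n := n) (p := p) (b := b) h0 hi h5 hb0 hn0 (fun q hq => ?_)
          (fun i hi => ?_) hW (by omega)).mono le_rfl ?_
        · obtain ⟨⟨c, hc, e⟩, -⟩ := hI q hq
          rw [e]
          exact hL _ (by omega)
        · rw [hl]; exact hL _ (by omega)
        · rintro s₁ ⟨h₁, h₂, h₃⟩ _ q hq
          simp only [State.setI_iarr]
          rw [hd, hl] at h₃
          rw [hl] at h₂
          rcases Nat.lt_succ_iff_lt_or_eq.1 hq with h | rfl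
          · exact (hI q h).congr fun q' hq' => h₁ q' (by omega)
          · have hs : ∀ x, score (rowKer (s.rarr 0) n) (s.iarr 2) (s₁.iarr 3) (q / b * b)
                (q - q / b * b) x = score (rowKer (s.rarr 0) n) (s.iarr 2) (s'.iarr 3) (q / b * b)
                (q - q / b * b) x := fun x => score_congr fun q' hq' => h₁ q' (by
                  have := Nat.div_mul_le_self q b; omega)
            refine ⟨h₂, fun c hc => ?_⟩
            rw [hs, hs]
            exact h₃ c hc
      · exact fun s' h _ => h
    intro s₁ h₁ hA₁
    have g6 := hA₁.ivar 6 (by decide)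
    have g5 := hA₁.ivar 5 (by decide)
    have gl := hA₁.iarr 2 (by decide)
    simp [hP, hb] at g6 g5 gl
    apply Runs.seq
    · apply Runs.forTo (N := P) (hN := by omega) (hi := by decide)
        (I := fun k s' => ∀ p < k, s'.iarr 2 p = s₁.iarr 3 p)
        (Q := fun s' => ∀ p < P, s'.iarr 2 p = s₁.iarr 3 p)
      · intro s' hA
        simp [hA.ivar 6 (by decide), g6]
      · simp
      · intro p s' hp hA hi hI
        have hl := hA.iarr 3 (by decide)
        apply Runs.istore (by simp) (by simp)
        intro q hq
        by_cases hqp : q = p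
        · simp [hi, hl, hqp]
        · simpa [hi, hl, Function.update_apply, hqp] using hI q (by omega)
      · exact fun s' h _ => h
    intro s₂ h₂ hA₂
    have f6 := hA₂.ivar 6 (by decide)
    have f5 := hA₂.ivar 5 (by decide)
    rw [g6] at f6
    rw [g5] at f5
    apply Runs.iset_seq (by simp)
    apply Runs.iset
    · simp [f5, hbW]; omega
    · simp [f5, f6]
      exact fun p hp => (h₁ p hp).congr fun q hq => h₂ q (by omega)
  · simp
    have h2 : 1 ≤ b * n := Nat.mul_pos hb0 hn0
    have h3 : 1 ≤ P * (b * n) := Nat.mul_pos hP0 h2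
    have h4 : P ≤ P * (b * n) := Nat.le_mul_of_pos_right _ h2
    have e1 : P * (b * (200000 * n)) = 200000 * (P * (b * n)) := by ring
    have e2 : P * (b * (100000 * n) + 1 + 8) = 100000 * (P * (b * n)) + 9 * P := by ring
    omega

/-! ### Iterating the levels: the sample and its cost. -/

/-- `L` is a list that the sampling procedure may have reached after `t` of its `u` levels. -/
inductive Reach (K : ℕ → ℕ → ℝ) (n M u : ℕ) : ℕ → (ℕ → ℕ) → Prop
  | zero (L : ℕ → ℕ) (h : ∀ i < M * 16 ^ u, L i = i % n) : Reach K n M u 0 L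
  | succ (t : ℕ) (L L' : ℕ → ℕ) (ht : t < u) (hL : Reach K n M u t L)
      (h : ∀ p < M * 16 ^ (u - (t + 1)), PickOK K L L' (M * 4 ^ t) p) : Reach K n M u (t + 1) L'

theorem Reach.lt {K : ℕ → ℕ → ℝ} {n M u t : ℕ} {L : ℕ → ℕ} (hn : 0 < n) (h : Reach K n M u t L) :
    ∀ p < M * 16 ^ (u - t), L p < n := by
  induction h with
  | zero L h => exact fun p hp => by rw [h p hp]; exact Nat.mod_lt _ hn
  | succ t L L' ht hL h ih =>
    intro p hp
    obtain ⟨⟨c, hc, e⟩, -⟩ := h p hp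
    rw [e]
    refine ih _ ?_
    have : u - t = u - (t + 1) + 1 := by omega
    rw [this, pow_succ, ← mul_assoc]
    omega

/-- Choose a sample of `i₃` rows. -/
def sampleProg : Prog :=
  -- Starting from length `M` and multiplying by 16 makes the final list have exactly `M` elements.
  -- The first block length is also `M`.
  .iset 4 (.var 3) ⨟ .iset 5 (.var 3) ⨟
  .loop (.not (.ile (.var 0) (.var 4))) (.iset 4 (.mul (.lit 16) (.var 4))) ⨟
  .forTo 23 (.var 4) (.istore 2 (.var 23) (.mod (.var 23) (.var 0))) ⨟
  .loop (.not (.ile (.var 4) (.var 3))) levelProg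

/-- A level costs list length times block length times `n`. The first factor falls by 16 and the
second grows by 4, so the costs decrease geometrically; the initial length is at most `17 * (M *
n)`. -/
theorem runs_sample {W n M : ℕ} {s : State} (hn : s.ivar 0 = n) (hM : s.ivar 3 = M)
    (hM0 : 0 < M) (hn0 : 0 < n) (hW : n * n ≤ W) (hMW : 17 * (M * n) ≤ W) :
    Runs W sampleProg s (400000 * (M * M * (n * n))) fun s' =>
      ∃ u, n ≤ M * 16 ^ u ∧ Reach (rowKer (s.rarr 0) n) n M u u (s'.iarr 2) := by
  have hMn : 1 ≤ M * n := Nat.mul_pos hM0 hn0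
  have hMn1 : n ≤ M * n := Nat.le_mul_of_pos_left _ hM0
  have hMn2 : M ≤ M * n := Nat.le_mul_of_pos_right _ hn0
  unfold sampleProg
  apply Runs.time
  · apply Runs.iset_seq (by simp)
    apply Runs.iset_seq (by simp)
    apply Runs.seq (T' := 17 * (M * n) * 20 + 20 + (20000 * (17 * (M * n) * (M * n)) + 5))
    -- The length is multiplied only while it is below `n`, so it stays at most `17 * (M * n)`, and
    -- it grows at least by one each time, which pays from the budget.
    · refine Runs.loop (τ := 20 * n + 10) (I := fun τ s' => s'.ivar 0 = n ∧ s'.ivar 3 = M ∧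
        s'.ivar 5 = M ∧ s'.rarr 0 = s.rarr 0 ∧ (∃ u, s'.ivar 4 = M * 16 ^ u) ∧
        s'.ivar 4 ≤ 17 * (M * n) ∧ 20 * (n - s'.ivar 4) + 10 ≤ τ)
        (Q := fun s' => s'.ivar 0 = n ∧ s'.ivar 3 = M ∧
        s'.ivar 5 = M ∧ s'.rarr 0 = s.rarr 0 ∧ ∃ u, s'.ivar 4 = M * 16 ^ u ∧ n ≤ M * 16 ^ u ∧
        M * 16 ^ u ≤ 17 * (M * n)) ?_ ?_
      · rintro τ s' ⟨h0, h3, h5, hd, ⟨u, h4⟩, h4', hτ⟩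
        refine ⟨by simp, fun hb => ?_, fun hb => ?_⟩
        · simp [h0] at hb
          refine ⟨⟨h0, h3, h5, hd, u, h4, h4 ▸ hb, h4 ▸ h4'⟩, ?_⟩
          simp
          omega
        · simp [h0] at hb
          have : 0 < s'.ivar 4 := by rw [h4]; positivity
          refine ⟨4, Runs.iset ?_ ⟨20 * (n - 16 * s'.ivar 4) + 10, ⟨?_, ?_, ?_, ?_, ⟨u + 1, ?_⟩, ?_,
            ?_⟩, ?_⟩⟩
          · simp; omega
          · simp [h0]
          · simp [h3]
          · simp [h5]
          · simp [hd]
          · simp [h4]; ring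
          · simp; omega
          · simp
          · simp; omega
      · exact ⟨by simp [hn], by simp [hM], by simp [hM], rfl, ⟨0, by simp [hM]⟩,
          by simp [hM]; omega, by simp⟩
    rintro s₁ ⟨h0, h3, h5, hd, u, h4, hu, hu'⟩ hA₁
    apply Runs.seq
    · apply Runs.time (T' := 17 * (M * n) * 20 + 20)
      on_goal 2 => exact (Nat.add_le_add_right (Nat.add_le_add_right
        (Nat.mul_le_mul hu' (show 5 + 1 + 8 ≤ 20 by norm_num)) 1) 6).trans (by omega)
      apply Runs.forTo (N := M * 16 ^ u) (hN := by omega) (hi := by decide)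
        (I := fun k s' => ∀ p < k, s'.iarr 2 p = p % n)
        (Q := fun s' => ∀ p < M * 16 ^ u, s'.iarr 2 p = p % n)
      · intro s' hA
        simp [hA.ivar 4 (by decide), h4]
      · simp
      · intro p s' hp hA hi hI
        have g0 := hA.ivar 0 (by decide)
        apply Runs.istore (by simp) (by simp [g0]; omega)
        intro q hq
        by_cases hqp : q = p
        · simp [hi, g0, h0, hqp]
        · simpa [hi, g0, h0, Function.update_apply, hqp] using hI q (by omega)
      · exact fun s' h _ => h
    intro s₂ h₂ hA₂
    -- The potential `M² 16 ^ j 4 ^ t n` drops to a quarter when `t` grows and `j` falls by one; the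
    -- difference pays for the level.
    refine Runs.loop (I := fun τ s' => s'.ivar 0 = n ∧
      s'.ivar 3 = M ∧ s'.rarr 0 = s.rarr 0 ∧ ∃ t j, t + j = u ∧ s'.ivar 4 = M * 16 ^ j ∧
      s'.ivar 5 = M * 4 ^ t ∧ Reach (rowKer (s.rarr 0) n) n M u t (s'.iarr 2) ∧
      20000 * (M * M * 16 ^ j * 4 ^ t * n) + 5 ≤ τ) ?_ ?_
    · rintro τ s' ⟨g0, g3, gd, t, j, htj, g4, g5, hR, hτ⟩
      refine ⟨by simp, fun hb => ?_, fun hb => ?_⟩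
      · simp [g4, g3] at hb
        have hj : j = 0 := by
          by_contra hj
          have := Nat.one_lt_pow hj (show 1 < 16 by norm_num)
          nlinarith
        subst hj
        obtain rfl : t = u := by omega
        exact ⟨⟨t, hu, hR⟩, by simp; omega⟩
      · simp [g4, g3] at hb
        obtain ⟨j, rfl⟩ : ∃ i, j = i + 1 := by
          refine ⟨j - 1, ?_⟩
          rcases j with _ | j
          · simp at hb
          · simp
        have e16 : M * 16 ^ (j + 1) = 16 * (M * 16 ^ j) := by ring
        have hle : M * 16 ^ (j + 1) ≤ M * 16 ^ u :=
          Nat.mul_le_mul_left _ (Nat.pow_le_pow_right (by norm_num) (by omega))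
        have hle4 : 4 * (M * 4 ^ t) ≤ M * 16 ^ u := by
          calc 4 * (M * 4 ^ t) = M * 4 ^ (t + 1) := by ring
            _ ≤ M * 16 ^ (t + 1) := Nat.mul_le_mul_left _ (Nat.pow_le_pow_left (by norm_num) _)
            _ ≤ M * 16 ^ u := Nat.mul_le_mul_left _ (Nat.pow_le_pow_right (by norm_num) (by omega))
        refine ⟨_, (runs_level (n := n) (P := M * 16 ^ j) (b := M * 4 ^ t) g0 (by rw [g4, e16]) g5
          (by positivity) hn0 (by positivity) (fun i hi => ?_) hW (by omega) (by omega)).mono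
          le_rfl ?_⟩
        · refine hR.lt hn0 i ?_
          rwa [show u - t = j + 1 by omega, e16]
        · rintro s₃ ⟨f4, f5, hp⟩ hA₃
          have f0 := hA₃.ivar 0 (by decide)
          have f3 := hA₃.ivar 3 (by decide)
          have fd := hA₃.rarr 0 (by decide)
          refine ⟨20000 * (M * M * 16 ^ j * 4 ^ (t + 1) * n) + 5, ⟨by rw [f0, g0], by rw [f3, g3],
            by rw [fd, gd], t + 1, j, by omega, f4, by rw [f5]; ring,
            .succ t _ _ (by omega) hR ?_, le_rfl⟩, ?_⟩
          · rw [show u - (t + 1) = j by omega]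
            rwa [gd] at hp
          · have e1 : M * M * 16 ^ (j + 1) * 4 ^ t * n = 16 * (M * M * 16 ^ j * 4 ^ t * n) := by ring
            have e2 : M * M * 16 ^ j * 4 ^ (t + 1) * n = 4 * (M * M * 16 ^ j * 4 ^ t * n) := by ring
            have e3 : M * 16 ^ j * (M * 4 ^ t * (200000 * n)) =
              200000 * (M * M * 16 ^ j * 4 ^ t * n) := by ring
            have e4 : 1 ≤ M * M * 16 ^ j * 4 ^ t * n := Nat.succ_le_of_lt (by positivity)
            rw [e3]
            simp
            omega
    · have f0 := hA₂.ivar 0 (by decide)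
      have f3 := hA₂.ivar 3 (by decide)
      have f4 := hA₂.ivar 4 (by decide)
      have f5 := hA₂.ivar 5 (by decide)
      have fd := hA₂.rarr 0 (by decide)
      refine ⟨f0.trans h0, f3.trans h3, fd.trans hd, 0, u, by simp, f4.trans h4, by simp [f5, h5],
        .zero _ h₂, ?_⟩
      have : M * 16 ^ u * (M * n) ≤ 17 * (M * n) * (M * n) := Nat.mul_le_mul_right _ hu'
      have e : M * M * 16 ^ u * 4 ^ 0 * n = M * 16 ^ u * (M * n) := by ring
      rw [e]
      omega
  · have e : 400000 * (M * M * (n * n)) = 400000 * ((M * n) * (M * n)) := by ring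
    have e' : 17 * (M * n) * (M * n) = 17 * ((M * n) * (M * n)) := by ring
    have h1 : M * n ≤ M * n * (M * n) := Nat.le_mul_self _
    rw [e, e']
    simp
    omega

/-! ### The error of the sampling procedure, in any real inner product space. -/

section Sampling

variable {H : Type*} [NormedAddCommGroup H]

/-- The error that the choice `L' p` from the group `p` causes. -/
def pickErr (f : ℕ → H) (L L' : ℕ → ℕ) (p : ℕ) : H :=
  ∑ c ∈ range 16, (f (L' p) - f (L (16 * p + c)))

variable {f : ℕ → H} {K : ℕ → ℕ → ℝ} {L L' : ℕ → ℕ} {n b P : ℕ} {ρ : ℝ}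

theorem sum_range_mul_sixteen (g : ℕ → H) (P : ℕ) :
    ∑ i ∈ range (16 * P), g i = ∑ p ∈ range P, ∑ c ∈ range 16, g (16 * p + c) := by
  induction P with
  | zero => simp
  | succ P ih => rw [mul_add, mul_one, sum_range_add, ih, ← sum_range_succ
      (fun p => ∑ c ∈ range 16, g (16 * p + c))]

theorem norm_pickErr_le (hf : ∀ i < n, ‖f i‖ ≤ ρ) (hL : ∀ i < 16 * P, L i < n)
    (hL' : ∀ p < P, L' p < n) {p : ℕ} (hp : p < P) : ‖pickErr f L L' p‖ ≤ 32 * ρ := by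
  calc ‖pickErr f L L' p‖ ≤ ∑ _c ∈ range 16, 2 * ρ := by
        refine norm_sum_le_of_le _ fun c hc => ?_
        have := mem_range.1 hc
        have h1 := hf _ (hL' p hp)
        have h2 := hf _ (hL (16 * p + c) (by omega))
        linarith [norm_sub_le (f (L' p)) (f (L (16 * p + c)))]
    _ = 32 * ρ := by simp; ring

variable [InnerProductSpace ℝ H]

/-- The kernel trick: a score is a correlation with the accumulated error vector, although only
values of `K` enter its computation. -/
theorem score_eq_inner (hK : ∀ y < n, ∀ x < n, K y x = inner ℝ (f y) (f x))
    (hL : ∀ i < 16 * P, L i < n) (hL' : ∀ p < P, L' p < n) {q₀ k x : ℕ} (hk : q₀ + k ≤ P)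
    (hx : x < n) :
    score K L L' q₀ k x = inner ℝ (∑ q ∈ range k, pickErr f L L' (q₀ + q)) (f x) := by
  rw [score, sum_inner]
  refine sum_congr rfl fun q hq => ?_
  have hq := mem_range.1 hq
  rw [pickErr, sum_inner]
  refine sum_congr rfl fun c hc => ?_
  have hc := mem_range.1 hc
  rw [inner_sub_left, hK _ (hL' _ (by omega)) _ hx, hK _ (hL _ (by omega)) _ hx]

/-- The error of a group is a sum of 16 differences, and the minimality of the chosen score makes
each of them correlate nonpositively with the earlier error in the block. -/
theorem inner_pickErr_le (hK : ∀ y < n, ∀ x < n, K y x = inner ℝ (f y) (f x))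
    (hL : ∀ i < 16 * P, L i < n) (hL' : ∀ p < P, L' p < n)
    (hP : ∀ p < P, PickOK K L L' b p) {p : ℕ} (hp : p < P) :
    inner ℝ (∑ q ∈ range (p - p / b * b), pickErr f L L' (p / b * b + q))
      (pickErr f L L' p) ≤ 0 := by
  have hle := Nat.div_mul_le_self p b
  conv_lhs => rw [pickErr, inner_sum]
  refine sum_nonpos fun c hc => ?_
  have hc := mem_range.1 hc
  have := (hP p hp).2 c hc
  rw [score_eq_inner hK hL hL' (by omega) (hL' p hp),
    score_eq_inner hK hL hL' (by omega) (hL _ (by omega))] at this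
  rw [inner_sub_right]
  linarith

/-- In `‖e + x‖² = ‖e‖² + 2 ⟨e, x⟩ + ‖x‖²` the cross term is nonpositive, so each further group adds
at most `(32 ρ)²`. -/
theorem norm_block_le (hK : ∀ y < n, ∀ x < n, K y x = inner ℝ (f y) (f x))
    (hf : ∀ i < n, ‖f i‖ ≤ ρ) (hL : ∀ i < 16 * P, L i < n) (hL' : ∀ p < P, L' p < n)
    (hP : ∀ p < P, PickOK K L L' b p) (i k : ℕ) (hk : k ≤ b) (hik : i * b + k ≤ P) :
    ‖∑ q ∈ range k, pickErr f L L' (i * b + q)‖ ^ 2 ≤ k * (32 * ρ) ^ 2 := by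
  induction k with
  | zero => simp
  | succ k ih =>
    have hdiv : (i * b + k) / b = i := by
      rw [mul_comm, Nat.mul_add_div (by omega), Nat.div_eq_of_lt (by omega), add_zero]
    have h1 := inner_pickErr_le hK hL hL' hP (p := i * b + k) (by omega)
    rw [hdiv, Nat.add_sub_cancel_left] at h1
    have h2 := norm_pickErr_le hf hL hL' (p := i * b + k) (by omega)
    have h3 : ‖pickErr f L L' (i * b + k)‖ ^ 2 ≤ (32 * ρ) ^ 2 :=
      pow_le_pow_left₀ (norm_nonneg _) h2 2
    rw [sum_range_succ, norm_add_sq_real]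
    have := ih (by omega) (by omega)
    push_cast
    linarith

/-- The triangle inequality over the blocks. At most `P / b` full blocks contribute `√b` units of
`32 ρ` each, and the last incomplete block at most `√P`; `β` and `γ` are these square roots. -/
theorem norm_level_le (hK : ∀ y < n, ∀ x < n, K y x = inner ℝ (f y) (f x)) (hρ : 0 ≤ ρ)
    (hf : ∀ i < n, ‖f i‖ ≤ ρ) (hL : ∀ i < 16 * P, L i < n) (hL' : ∀ p < P, L' p < n)
    (hP : ∀ p < P, PickOK K L L' b p) {β γ : ℝ} (hβ : 0 < β) (hγ : 0 ≤ γ) (hb : (b : ℝ) = β ^ 2)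
    (hPγ : (P : ℝ) = γ ^ 2) :
    ‖∑ p ∈ range P, pickErr f L L' p‖ ≤ 32 * ρ * (P / β + γ) := by
  have hblock : ∀ i, i * b ≤ P → ‖∑ q ∈ range (i * b), pickErr f L L' q‖ ≤ i * β * (32 * ρ) := by
    intro i hi
    induction i with
    | zero => simp
    | succ i ih =>
      rw [add_mul, one_mul] at hi ⊢
      rw [sum_range_add]
      refine (norm_add_le _ _).trans ?_
      have h1 := norm_block_le hK hf hL hL' hP i b le_rfl hi
      have h2 : ‖∑ q ∈ range b, pickErr f L L' (i * b + q)‖ ≤ β * (32 * ρ) := by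
        refine abs_le_of_sq_le_sq' ?_ (by positivity) |>.2
        rw [mul_pow, ← hb]; exact h1
      have := ih (by omega)
      push_cast
      linarith
  have hdm := Nat.div_add_mod' P b
  have hb0 : 0 < b := by
    have : (0 : ℝ) < b := by rw [hb]; positivity
    exact_mod_cast this
  have h1 := hblock (P / b) (by omega)
  have h2 := norm_block_le hK hf hL hL' hP (P / b) (P % b) (Nat.mod_lt _ hb0).le (by omega)
  have h3 : ‖∑ q ∈ range (P % b), pickErr f L L' (P / b * b + q)‖ ≤ γ * (32 * ρ) := by
    refine abs_le_of_sq_le_sq' ?_ (by positivity) |>.2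
    rw [mul_pow, ← hPγ]
    refine h2.trans ?_
    gcongr
    exact Nat.mod_le _ _
  have h4 : ((P / b : ℕ) : ℝ) * β ≤ P / β := by
    rw [le_div_iff₀ hβ, mul_assoc, ← sq, ← hb]
    exact_mod_cast Nat.div_mul_le_self P b
  conv_lhs => rw [← hdm, sum_range_add]
  refine (norm_add_le _ _).trans ?_
  have : ((P / b : ℕ) : ℝ) * β * (32 * ρ) ≤ P / β * (32 * ρ) := by gcongr
  linarith

/-- Each chosen element stands for its whole group, hence the weight 16. -/
theorem sum_pickErr (f : ℕ → H) (L L' : ℕ → ℕ) (P : ℕ) :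
    ∑ p ∈ range P, pickErr f L L' p =
      (16 : ℝ) • ∑ p ∈ range P, f (L' p) - ∑ i ∈ range (16 * P), f (L i) := by
  rw [sum_range_mul_sixteen, smul_sum, ← sum_sub_distrib]
  refine sum_congr rfl fun p _ => ?_
  rw [pickErr, sum_sub_distrib, sum_const, card_range, ← Nat.cast_smul_eq_nsmul ℝ]
  norm_num

/-- Scaled by `16 ^ t`, level `t` adds errors proportional to `2 ^ (-t)` from full blocks and to `4
^ (t - u)` from incomplete blocks. The last factor is the sum of these two geometric series: the
first is dominated by the early levels, the second by the late ones. -/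
theorem Reach.norm_le {B u t : ℕ} (hB : 0 < B) (hn : 0 < n)
    (hK : ∀ y < n, ∀ x < n, K y x = inner ℝ (f y) (f x)) (hρ : 0 ≤ ρ)
    (hf : ∀ i < n, ‖f i‖ ≤ ρ) (h : Reach K n (B * B) u t L) :
    t ≤ u ∧ ‖(16 : ℝ) ^ t • ∑ p ∈ range (B * B * 16 ^ (u - t)), f (L p) -
        ∑ i ∈ range (B * B * 16 ^ u), f (i % n)‖ ≤
      2 * ρ * B * 16 ^ u * (2 - 2 / 2 ^ t + 4 / 3 * (4 ^ t / 4 ^ u)) := by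
  induction h with
  | zero L h =>
    refine ⟨Nat.zero_le _, ?_⟩
    rw [tsub_zero, pow_zero, one_smul, sum_congr rfl fun i hi => by rw [h i (mem_range.1 hi)],
      sub_self, norm_zero]
    norm_num
    positivity
  | succ t L L' ht hL h ih =>
    refine ⟨ht, ?_⟩
    obtain ⟨j, rfl⟩ : ∃ j, u = t + 1 + j := ⟨u - (t + 1), by omega⟩
    have ej : t + 1 + j - (t + 1) = j := by omega
    have ej' : t + 1 + j - t = j + 1 := by omega
    have hlt := hL.lt hn
    have hlt' := (Reach.succ t L L' ht hL h).lt hn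
    rw [ej] at h hlt' ⊢
    rw [ej'] at hlt ih
    have e16 : B * B * 16 ^ (j + 1) = 16 * (B * B * 16 ^ j) := by ring
    rw [e16] at hlt ih
    have h1 := norm_level_le (f := f) (P := B * B * 16 ^ j) (b := B * B * 4 ^ t) (β := B * 2 ^ t)
      (γ := B * 4 ^ j) hK hρ hf hlt hlt' h (by positivity) (by positivity)
      (by push_cast; rw [show (4 : ℝ) = 2 ^ 2 by norm_num, ← pow_mul]; ring)
      (by push_cast; rw [show (16 : ℝ) = 4 ^ 2 by norm_num, ← pow_mul]; ring)
    rw [sum_pickErr] at h1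
    have h2 : ‖(16 : ℝ) ^ t • ((16 : ℝ) • ∑ p ∈ range (B * B * 16 ^ j), f (L' p) -
        ∑ i ∈ range (16 * (B * B * 16 ^ j)), f (L i))‖ ≤
        16 ^ t * (32 * ρ * (((B * B * 16 ^ j : ℕ) : ℝ) / (B * 2 ^ t) + B * 4 ^ j)) := by
      rw [norm_smul, norm_pow, Real.norm_ofNat]
      gcongr
    have h3 := norm_add_le_of_le h2 ih.2
    refine le_of_eq_of_le ?_ (h3.trans (le_of_eq ?_))
    · congr 1
      rw [smul_sub, smul_smul, pow_succ]
      abel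
    · have e4 : (16 : ℝ) ^ j = 4 ^ j * 4 ^ j := by
        rw [← mul_pow]; norm_num
      have hB' : (B : ℝ) ≠ 0 := by positivity
      push_cast
      simp only [pow_add, pow_one, e4]
      field_simp
      ring

/-- Some sampled vector is well correlated with the sum of all the vectors. -/
theorem Reach.exists_le_inner {B u : ℕ} (hB : 0 < B) (hn : 0 < n) (hnu : n ≤ B * B * 16 ^ u)
    (hK : ∀ y < n, ∀ x < n, K y x = inner ℝ (f y) (f x))
    (hf : ∀ i < n, ‖f i‖ ≤ n) (h : Reach K n (B * B) u u L) {h₀ : H}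
    (hh₀ : h₀ = ∑ i ∈ range n, f i) (hpos : ∀ i < n, 0 ≤ inner ℝ (f i) h₀) :
    ∃ p < B * B, ‖h₀‖ * (‖h₀‖ / (2 * n) - 8 * n / B) ≤ inner ℝ (f (L p)) h₀ := by
  have h1 := (h.norm_le hB hn hK (Nat.cast_nonneg n) hf).2
  rw [tsub_self, pow_zero, mul_one] at h1
  set N := B * B * 16 ^ u with hN
  have hB' : (0 : ℝ) < B := by exact_mod_cast hB
  have hn' : (0 : ℝ) < n := by exact_mod_cast hn
  have h2 : ‖(16 : ℝ) ^ u • ∑ p ∈ range (B * B), f (L p) - ∑ i ∈ range N, f (i % n)‖ ≤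
      8 * n * B * 16 ^ u := by
    refine h1.trans ?_
    have : (2 : ℝ) - 2 / 2 ^ u + 4 / 3 * (4 ^ u / 4 ^ u) ≤ 4 := by
      rw [div_self (by positivity)]
      have : (0 : ℝ) < 2 / 2 ^ u := by positivity
      linarith
    calc (2 : ℝ) * n * B * 16 ^ u * (2 - 2 / 2 ^ u + 4 / 3 * (4 ^ u / 4 ^ u)) ≤
        2 * n * B * 16 ^ u * 4 := by gcongr
      _ = _ := by ring
  have h3 := abs_le.1 ((abs_real_inner_le_norm ((16 : ℝ) ^ u • ∑ p ∈ range (B * B), f (L p) -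
    ∑ i ∈ range N, f (i % n)) h₀).trans (mul_le_mul_of_nonneg_right h2 (norm_nonneg _)))
  rw [inner_sub_left, real_inner_smul_left, sum_inner, sum_inner] at h3
  -- Each full pass of the cyclic list through all rows contributes `⟨h₀, h₀⟩`.
  have h4 : ∀ k : ℕ, (k : ℝ) * ‖h₀‖ ^ 2 ≤ ∑ i ∈ range (k * n), inner ℝ (f (i % n)) h₀ := by
    intro k
    induction k with
    | zero => simp
    | succ k ih =>
      rw [add_mul, one_mul, sum_range_add]
      have : ∑ i ∈ range n, inner ℝ (f ((k * n + i) % n)) h₀ = ‖h₀‖ ^ 2 := by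
        have e := congrArg (fun v => inner ℝ v h₀) hh₀
        simp only [sum_inner] at e
        rw [← real_inner_self_eq_norm_sq, e]
        refine sum_congr rfl fun i hi => ?_
        rw [Nat.mul_add_mod_self_right, Nat.mod_eq_of_lt (mem_range.1 hi)]
      rw [this]; push_cast; linarith
  -- As `N ≥ n`, rounding down the number of passes loses at most a factor 2; the unfinished pass
  -- contributes a nonnegative amount.
  have h5 : (N : ℝ) / (2 * n) * ‖h₀‖ ^ 2 ≤ ∑ i ∈ range N, inner ℝ (f (i % n)) h₀ := by
    refine le_trans ?_ ((h4 (N / n)).trans (sum_le_sum_of_subset_of_nonneg ?_ ?_))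
    · refine mul_le_mul_of_nonneg_right ?_ (by positivity)
      rw [div_le_iff₀ (by positivity)]
      have hd := Nat.div_add_mod' N n
      have hm := Nat.mod_lt N hn
      have hq : 1 ≤ N / n := Nat.div_pos hnu hn
      have : N ≤ N / n * (2 * n) := by nlinarith
      exact_mod_cast this
    · exact range_subset_range.2 (Nat.div_mul_le_self N n)
    · exact fun i _ _ => hpos _ (Nat.mod_lt _ hn)
  -- If all sampled correlations were too small, their sum would contradict the lower bound for the
  -- cyclic list and the sampling error.
  by_contra! hcon
  have h6 : ∑ p ∈ range (B * B), inner ℝ (f (L p)) h₀ <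
      ∑ _p ∈ range (B * B), ‖h₀‖ * (‖h₀‖ / (2 * n) - 8 * n / B) :=
    sum_lt_sum_of_nonempty (nonempty_range_iff.2 (by positivity))
      fun p hp => hcon p (mem_range.1 hp)
  rw [sum_const, card_range, nsmul_eq_mul] at h6
  have h7 := mul_lt_mul_of_pos_left h6 (show (0 : ℝ) < 16 ^ u by positivity)
  have e : (16 : ℝ) ^ u * (((B * B : ℕ) : ℝ) * (‖h₀‖ * (‖h₀‖ / (2 * n) - 8 * n / B))) =
      (N : ℝ) / (2 * n) * ‖h₀‖ ^ 2 - 8 * n * B * 16 ^ u * ‖h₀‖ := by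
    rw [hN]
    push_cast
    field_simp
  rw [e] at h7
  linarith [h3.1]

end Sampling

/-! ### Tensor squares of rows, and the spectral norm. -/

/-- The tensor square of a vector. -/
noncomputable def tens (n : ℕ) (a : ℕ → ℝ) : EuclideanSpace ℝ (Fin n × Fin n) :=
  WithLp.toLp 2 fun p => a p.1 * a p.2

theorem inner_tens (n : ℕ) (a b : ℕ → ℝ) :
    inner ℝ (tens n a) (tens n b) = (∑ j ∈ range n, a j * b j) ^ 2 := by
  rw [← Fin.sum_univ_eq_sum_range (fun j => a j * b j), sq, sum_mul_sum, ← sum_product',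
    univ_product_univ, PiLp.inner_apply]
  refine sum_congr rfl fun p _ => ?_
  simp [tens]
  ring

theorem norm_tens (n : ℕ) (a : ℕ → ℝ) : ‖tens n a‖ = ∑ j ∈ range n, a j ^ 2 := by
  have h : ‖tens n a‖ ^ 2 = (∑ j ∈ range n, a j ^ 2) ^ 2 := by
    rw [← real_inner_self_eq_norm_sq, inner_tens]
    simp only [sq]
  exact (pow_left_inj₀ (norm_nonneg _) (sum_nonneg fun _ _ => sq_nonneg _) two_ne_zero).1 h

/-- If the sampled rows have small images, then the spectral norm is small. -/
theorem Reach.sum_sq_le {d : ℕ → ℝ} {n B u : ℕ} {L : ℕ → ℕ} {ε : ℝ} (hn : 0 < n) (hB0 : 0 < B)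
    (hrow : ∀ i < n, ∑ j ∈ range n, d (i * n + j) ^ 2 ≤ n) (hB : 32 ≤ B * ε ^ 2)
    (hnu : n ≤ B * B * 16 ^ u) (h : Reach (rowKer d n) n (B * B) u u L)
    (hfail : ∀ p < B * B, ∑ k ∈ range n, rowDot d n k (L p) ^ 2 < ε ^ 4 * n ^ 3 / 4) (x : ℕ → ℝ) :
    ∑ k ∈ range n, (∑ j ∈ range n, d (k * n + j) * x j) ^ 2 ≤
      (ε * n) ^ 2 * ∑ j ∈ range n, x j ^ 2 := by
  have hn' : (0 : ℝ) < n := by exact_mod_cast hn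
  have hB' : (0 : ℝ) < B := by exact_mod_cast hB0
  set f : ℕ → EuclideanSpace ℝ (Fin n × Fin n) := fun i => tens n fun j => d (i * n + j) with hf
  -- `h₀` is `DᵀD` as a vector, and its norm is the Frobenius norm.
  set h₀ := ∑ i ∈ range n, f i with hh₀
  have hin : ∀ i, inner ℝ (f i) h₀ = ∑ k ∈ range n, rowDot d n k i ^ 2 := by
    intro i
    rw [hh₀, inner_sum]
    refine sum_congr rfl fun k _ => ?_
    rw [hf, inner_tens, rowDot]
    simp only [mul_comm]
  obtain ⟨p, hp, hle⟩ := h.exists_le_inner (f := f) hB0 hn hnu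
    (fun y _ x _ => by rw [hf, inner_tens, rowKer, rowDot, ← sq]; simp only [mul_comm])
    (fun i hi => by rw [hf, norm_tens]; exact hrow i hi) hh₀
    (fun i _ => by rw [hin]; exact sum_nonneg fun _ _ => sq_nonneg _)
  have hlt := hfail p hp
  rw [hin] at hle
  -- Otherwise `‖h₀‖ / (2 n)` exceeds `ε² n / 2`. As `32 ≤ B ε²`, the sampling error takes away at
  -- most half of this, and the sampled row has correlation at least `ε⁴ n³ / 4`, against `hfail`.
  have hnorm : ‖h₀‖ ≤ ε ^ 2 * n ^ 2 := by
    by_contra! hcon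
    have h1 : ε ^ 2 * n / 4 ≤ ‖h₀‖ / (2 * n) - 8 * n / B := by
      have h2 : ε ^ 2 * n / 2 ≤ ‖h₀‖ / (2 * n) := by
        rw [le_div_iff₀ (by positivity)]
        nlinarith
      have h3 : 8 * n / B ≤ ε ^ 2 * n / 4 := by
        rw [div_le_iff₀ hB']
        nlinarith
      linarith
    have h4 : ε ^ 2 * n ^ 2 * (ε ^ 2 * n / 4) ≤ ‖h₀‖ * (‖h₀‖ / (2 * n) - 8 * n / B) :=
      mul_le_mul hcon.le h1 (by positivity) (norm_nonneg _)
    nlinarith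
  -- `‖D x‖² = ⟨DᵀD, x ⊗ x⟩`, to which Cauchy–Schwarz applies.
  have hx : ∑ k ∈ range n, (∑ j ∈ range n, d (k * n + j) * x j) ^ 2 = inner ℝ h₀ (tens n x) := by
    rw [hh₀, sum_inner]
    exact sum_congr rfl fun k _ => by rw [hf, inner_tens]
  rw [hx]
  refine (real_inner_le_norm _ _).trans ?_
  rw [norm_tens]
  refine mul_le_mul_of_nonneg_right (hnorm.trans (by rw [mul_pow])) (sum_nonneg fun _ _ => sq_nonneg _)

/-! ### From a row with large image to a heavy cut. -/

theorem exists_sign_sum_abs_le (g : ℕ → ℝ) (n : ℕ) : ∃ σ : ℝ, (σ = 1 ∨ σ = -1) ∧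
    ∑ j ∈ range n, |g j| ≤ 2 * ∑ j ∈ range n, if 0 < σ * g j then σ * g j else 0 := by
  -- The absolute values are the positive parts of `g` and `-g` together; the larger of the two sums
  -- is at least half.
  have h : ∑ j ∈ range n, |g j| = (∑ j ∈ range n, if 0 < 1 * g j then 1 * g j else 0) +
      ∑ j ∈ range n, if 0 < -1 * g j then -1 * g j else 0 := by
    rw [← sum_add_distrib]
    refine sum_congr rfl fun j _ => ?_
    rcases lt_trichotomy (g j) 0 with h | h | h
    · simp [abs_of_neg h, h, not_lt.2 h.le]
    · simp [h]
    · simp [abs_of_pos h, h, not_lt.2 h.le]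
  by_cases h' : (∑ j ∈ range n, if 0 < -1 * g j then -1 * g j else 0) ≤
      ∑ j ∈ range n, if 0 < 1 * g j then 1 * g j else 0
  · exact ⟨1, .inl rfl, by linarith⟩
  · exact ⟨-1, .inr rfl, by linarith⟩

/-- The image under the transpose of the vector of the inner products with the row `i`. -/
def candW (d : ℕ → ℝ) (n i j : ℕ) : ℝ := ∑ k ∈ range n, d (k * n + j) * rowDot d n k i

open Classical in
/-- The set of columns of the candidate for the row `i` and the sign `σ`. -/
noncomputable def candT (d : ℕ → ℝ) (n i : ℕ) (σ : ℝ) (j : ℕ) : ℕ :=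
  if 0 < σ * candW d n i j then 1 else 0

/-- The row sums over the columns of the candidate. -/
noncomputable def candQ (d : ℕ → ℝ) (n i : ℕ) (σ : ℝ) (k : ℕ) : ℝ :=
  ∑ j ∈ range n, d (k * n + j) * candT d n i σ j

open Classical in
/-- The weight of the candidate for the row `i` and the signs `σ`, `σ'`. -/
noncomputable def candV (d : ℕ → ℝ) (n i : ℕ) (σ σ' : ℝ) : ℝ :=
  ∑ k ∈ range n, if 0 < σ' * candQ d n i σ k then σ' * candQ d n i σ k else 0

theorem rowDot_sq_le {d : ℕ → ℝ} {n : ℕ} (hrow : ∀ i < n, ∑ j ∈ range n, d (i * n + j) ^ 2 ≤ n)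
    {k i : ℕ} (hk : k < n) (hi : i < n) : rowDot d n k i ^ 2 ≤ n ^ 2 := by
  refine (sum_mul_sq_le_sq_mul_sq _ _ _).trans ?_
  rw [sq (n : ℝ)]
  exact mul_le_mul (hrow k hk) (hrow i hi) (sum_nonneg fun _ _ => sq_nonneg _) (Nat.cast_nonneg n)

/-- Let `a` be row `i`, `z = D a`, `w = Dᵀ z` and `Z = ‖z‖² = ⟨w, a⟩`. Then `Z² ≤ ‖w‖² n`, and since
`|w_j| ≤ n²` also `‖w‖² ≤ n² ‖w‖₁`; thus `‖w‖₁ ≥ δ² n³`. Half of this comes from the columns `T`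
where `w` has sign `σ`. It equals `σ ⟨z, D 1_T⟩`, at most `n ‖D 1_T‖₁` because `|z_k| ≤ n`. Rounding
`D 1_T` by its sign loses another factor 2. -/
theorem exists_le_candV {d : ℕ → ℝ} {n i : ℕ} {δ : ℝ} (hn : 0 < n) (hi : i < n) (hδ : 0 ≤ δ)
    (hrow : ∀ i < n, ∑ j ∈ range n, d (i * n + j) ^ 2 ≤ n)
    (hcol : ∀ j < n, ∑ i ∈ range n, d (i * n + j) ^ 2 ≤ n)
    (h : δ * n ^ 3 ≤ ∑ k ∈ range n, rowDot d n k i ^ 2) :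
    ∃ σ σ' : ℝ, (σ = 1 ∨ σ = -1) ∧ (σ' = 1 ∨ σ' = -1) ∧ δ ^ 2 * n ^ 2 / 4 ≤ candV d n i σ σ' := by
  have hn' : (0 : ℝ) < n := by exact_mod_cast hn
  set Z := ∑ k ∈ range n, rowDot d n k i ^ 2 with hZ
  have hz : ∀ k < n, |rowDot d n k i| ≤ n := fun k hk =>
    abs_le_of_sq_le_sq (rowDot_sq_le hrow hk hi) hn'.le
  have hZle : Z ≤ n * n ^ 2 := by
    calc Z ≤ ∑ _k ∈ range n, (n : ℝ) ^ 2 :=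
          sum_le_sum fun k hk => rowDot_sq_le hrow (mem_range.1 hk) hi
      _ = _ := by simp
  have hw : ∀ j < n, |candW d n i j| ≤ n ^ 2 := fun j hj => by
    refine abs_le_of_sq_le_sq ?_ (by positivity)
    refine (sum_mul_sq_le_sq_mul_sq _ _ _).trans ?_
    calc (∑ k ∈ range n, d (k * n + j) ^ 2) * Z ≤ n * (n * n ^ 2) :=
          mul_le_mul (hcol j hj) hZle (sum_nonneg fun _ _ => sq_nonneg _) hn'.le
      _ = _ := by ring
  have hwZ : ∑ j ∈ range n, candW d n i j * d (i * n + j) = Z := by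
    simp only [candW, sum_mul]
    rw [sum_comm]
    refine sum_congr rfl fun k _ => ?_
    trans rowDot d n k i * ∑ j ∈ range n, d (k * n + j) * d (i * n + j)
    · rw [mul_sum]
      exact sum_congr rfl fun j _ => by ring
    · exact (sq _).symm
  have hw2 : Z ^ 2 ≤ (∑ j ∈ range n, candW d n i j ^ 2) * n := by
    rw [← hwZ]
    refine (sum_mul_sq_le_sq_mul_sq _ _ _).trans ?_
    exact mul_le_mul_of_nonneg_left (hrow i hi) (sum_nonneg fun _ _ => sq_nonneg _)
  have hw1 : ∑ j ∈ range n, candW d n i j ^ 2 ≤ n ^ 2 * ∑ j ∈ range n, |candW d n i j| := by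
    rw [mul_sum]
    refine sum_le_sum fun j hj => ?_
    rw [← sq_abs, sq]
    exact mul_le_mul_of_nonneg_right (hw j (mem_range.1 hj)) (abs_nonneg _)
  have hwabs : δ ^ 2 * n ^ 3 ≤ ∑ j ∈ range n, |candW d n i j| := by
    have h1 : (δ * n ^ 3) ^ 2 ≤ Z ^ 2 := pow_le_pow_left₀ (by positivity) h 2
    have h2 : (δ ^ 2 * n ^ 3) * n ^ 3 ≤ (∑ j ∈ range n, |candW d n i j|) * n ^ 3 := by
      nlinarith
    exact le_of_mul_le_mul_right h2 (by positivity)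
  obtain ⟨σ, hσ, h1⟩ := exists_sign_sum_abs_le (candW d n i) n
  obtain ⟨σ', hσ', h2⟩ := exists_sign_sum_abs_le (candQ d n i σ) n
  refine ⟨σ, σ', hσ, hσ', ?_⟩
  have hσabs : |σ| = 1 := by rcases hσ with rfl | rfl <;> simp
  -- Duality: pairing `Dᵀ z` with `1_T` is pairing `z` with `D 1_T`.
  have h3 : (∑ j ∈ range n, if 0 < σ * candW d n i j then σ * candW d n i j else 0) =
      σ * ∑ k ∈ range n, rowDot d n k i * candQ d n i σ k := by
    have e1 : ∀ j, (if 0 < σ * candW d n i j then σ * candW d n i j else 0) =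
        σ * ∑ k ∈ range n, d (k * n + j) * rowDot d n k i * candT d n i σ j := by
      intro j
      rw [← sum_mul, ← candW, candT]
      split_ifs <;> simp
    simp only [e1, ← mul_sum]
    rw [sum_comm]
    congr 1
    refine sum_congr rfl fun k _ => ?_
    rw [candQ, mul_sum]
    exact sum_congr rfl fun j _ => by ring
  have h4 : σ * ∑ k ∈ range n, rowDot d n k i * candQ d n i σ k ≤
      n * ∑ k ∈ range n, |candQ d n i σ k| := by
    refine (le_abs_self _).trans ?_
    rw [abs_mul, hσabs, one_mul, mul_sum]
    refine (abs_sum_le_sum_abs _ _).trans (sum_le_sum fun k hk => ?_)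
    rw [abs_mul]
    exact mul_le_mul_of_nonneg_right (hz k (mem_range.1 hk)) (abs_nonneg _)
  rw [h3] at h1
  have h5 : δ ^ 2 * n ^ 3 ≤ 2 * (n * (2 * candV d n i σ σ')) := by
    have : (n : ℝ) * ∑ k ∈ range n, |candQ d n i σ k| ≤ n * (2 * candV d n i σ σ') := by
      unfold candV
      convert mul_le_mul_of_nonneg_left h2 hn'.le
    linarith
  have h6 : (δ ^ 2 * n ^ 2) * n ≤ (4 * candV d n i σ σ') * n := by nlinarith
  linarith [le_of_mul_le_mul_right h6 hn']

/-! ### The search for a heavy cut among the candidates. -/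

/-- The sign that is given by the parity of `m`. -/
def paritySign (m : ℕ) : ℝ := 1 - 2 * ((m % 2 : ℕ) : ℝ)

theorem paritySign_eq (m : ℕ) : paritySign m = 1 ∨ paritySign m = -1 := by
  unfold paritySign
  rcases Nat.mod_two_eq_zero_or_one m with h | h <;> rw [h] <;> norm_num

/-- The integer arrays `S` and `T` are incidence vectors, and the weight of the cut is at least
`v`. -/
structure GoodCut (d : ℕ → ℝ) (n : ℕ) (σ : ℝ) (S T : ℕ → ℕ) (v : ℝ) : Prop where
  left : ∀ k < n, S k = 0 ∨ S k = 1
  right : ∀ j < n, T j = 0 ∨ T j = 1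
  sign : σ = 1 ∨ σ = -1
  le : v ≤ ∑ k ∈ range n, (S k : ℝ) * ∑ j ∈ range n, (T j : ℝ) * (σ * d (k * n + j))

/-- `a₂ := ` the vector of the inner products with the row `i₂₁`. -/
def candZProg : Prog :=
  .forTo 33 (.var 0) (.iset 20 (.var 33) ⨟ kern ⨟ .rstore 2 (.var 33) (.var 10))

theorem runs_candZ {W n i : ℕ} {s : State} (hn : s.ivar 0 = n) (hi : s.ivar 21 = i) (hin : i < n)
    (hW : n * n ≤ W) :
    Runs W candZProg s (100 * (n * n)) fun s' => ∀ k < n, s'.rarr 2 k = rowDot (s.rarr 0) n k i := by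
  have hnn : n ≤ n * n := Nat.le_mul_self n
  unfold candZProg
  apply Runs.time
  · apply Runs.forTo (N := n) (hN := by omega) (hi := by decide)
      (I := fun k s' => ∀ q < k, s'.rarr 2 q = rowDot (s.rarr 0) n q i)
    · intro s' hA
      simp [hA.ivar 0 (by decide), hn]
    · simp
    · intro k s' hk hA hk' hI
      have h0 := hA.ivar 0 (by decide)
      have h21 := hA.ivar 21 (by decide)
      have hd := hA.rarr 0 (by decide)
      apply Runs.iset_seq (by simp)
      apply Runs.seq
      · exact runs_kern (n := n) (x := k) (y := i) (by simp [h0, hn]) (by simp [hk'])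
          (by simp [h21, hi]) hk hin hW
      intro s₁ h₁ hA₁
      have g33 := hA₁.ivar 33 (by decide)
      have gz := hA₁.rarr 2 (by decide)
      simp [hk'] at g33 gz
      simp only [State.setI_rarr, hd] at h₁
      apply Runs.rstore (by simp) (by simp)
      intro q hq
      by_cases hqk : q = k
      · simp [g33, hqk, h₁]
      · simpa [g33, gz, Function.update_apply, hqk] using hI q (by omega)
    · exact fun s' h _ => h
  · simp
    have : 1 ≤ n * n := Nat.mul_pos (by omega) (by omega)
    linarith

/-- `a₅ := ` the incidence vector of the columns of the candidate. -/
def candTProg : Prog :=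
  .forTo 34 (.var 0) (.rset 15 (.ofNat (.lit 0)) ⨟
    .forTo 33 (.var 0) (.rset 15 (.add (.var 15) (.mul (.load 0 (adr 33 34)) (.load 2 (.var 33))))) ⨟
    .ite (.not (.rle (.mul (.var 13) (.var 15)) (.ofNat (.lit 0)))) (.istore 5 (.var 34) (.lit 1))
      (.istore 5 (.var 34) (.lit 0)))

theorem runs_candT {W n i : ℕ} {s : State} (hn : s.ivar 0 = n) (hn0 : 0 < n)
    (hz : ∀ k < n, s.rarr 2 k = rowDot (s.rarr 0) n k i) (hW : n * n ≤ W) :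
    Runs W candTProg s (200 * (n * n)) fun s' =>
      ∀ j < n, s'.iarr 5 j = candT (s.rarr 0) n i (s.rvar 13) j := by
  have hnn : n ≤ n * n := Nat.le_mul_self n
  unfold candTProg
  apply Runs.time
  · apply Runs.forTo (N := n) (hN := by omega) (hi := by decide)
      (I := fun k s' => ∀ q < k, s'.iarr 5 q = candT (s.rarr 0) n i (s.rvar 13) q)
    · intro s' hA
      simp [hA.ivar 0 (by decide), hn]
    · simp
    · intro j s' hj hA hj' hI
      have h0 := hA.ivar 0 (by decide)
      have h13 := hA.rvar 13 (by decide)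
      have hd := hA.rarr 0 (by decide)
      have hz' := hA.rarr 2 (by decide)
      apply Runs.rset_seq (by simp)
      apply Runs.seq
      · apply Runs.forTo (N := n) (hN := by omega) (hi := by decide)
          (I := fun k s' => s'.rvar 15 =
            ∑ k ∈ range k, s.rarr 0 (k * n + j) * rowDot (s.rarr 0) n k i)
          (Q := fun s' => s'.rvar 15 = candW (s.rarr 0) n i j)
        · intro s₁ hA₁
          simp [hA₁.ivar 0 (by decide), h0, hn]
        · simp
        · intro k s₁ hk hA₁ hk' hI₁
          have g0 := hA₁.ivar 0 (by decide)
          have g34 := hA₁.ivar 34 (by decide)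
          have gd := hA₁.rarr 0 (by decide)
          have gz := hA₁.rarr 2 (by decide)
          simp [h0, hn, hj', hd, hz'] at g0 g34 gd gz
          have := adr_lt hk hj
          apply Runs.rset
          · simp [g0, g34, hk']; omega
          · simp [g0, g34, hk', gd, gz, hI₁, hz k hk, sum_range_succ]
        · exact fun s' h _ => h
      intro s₁ h₁ hA₁
      have g34 := hA₁.ivar 34 (by decide)
      have g13 := hA₁.rvar 13 (by decide)
      have g5 := hA₁.iarr 5 (by decide)
      simp [hj', h13] at g34 g13 g5
      apply Runs.ite_max (by simp)
      · intro hb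
        simp [h₁, g13] at hb
        apply Runs.istore (by simp) (by simp; nlinarith)
        intro q hq
        by_cases hqj : q = j
        · simp [g34, hqj, candT, hb]
        · simpa [g34, g5, Function.update_apply, hqj] using hI q (by omega)
      · intro hb
        simp [h₁, g13] at hb
        apply Runs.istore (by simp) (by simp)
        intro q hq
        by_cases hqj : q = j
        · simp [g34, hqj, candT, not_lt.2 hb]
        · simpa [g34, g5, Function.update_apply, hqj] using hI q (by omega)
    · exact fun s' h _ => h
  · simp
    have : 1 ≤ n * n := Nat.mul_pos hn0 hn0
    linarith

/-- `a₄ := ` the incidence vector of the rows of the candidate, `r₁₆ := ` its weight. -/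
def candSProg : Prog :=
  .rset 16 (.ofNat (.lit 0)) ⨟
  .forTo 33 (.var 0) (.rset 15 (.ofNat (.lit 0)) ⨟
    .forTo 34 (.var 0) (.rset 15 (.add (.var 15)
      (.mul (.load 0 (adr 33 34)) (.ofNat (.load 5 (.var 34)))))) ⨟
    .rset 15 (.mul (.var 14) (.var 15)) ⨟
    .ite (.not (.rle (.var 15) (.ofNat (.lit 0))))
      (.istore 4 (.var 33) (.lit 1) ⨟ .rset 16 (.add (.var 16) (.var 15)))
      (.istore 4 (.var 33) (.lit 0)))

/-- The weight is given in two forms: as `candV`, which bounds it when the search fails, and as a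
sum over the cut, which is needed when it succeeds. -/
theorem runs_candS {W n i : ℕ} {σ : ℝ} {s : State} (hn : s.ivar 0 = n) (hn0 : 0 < n)
    (hT : ∀ j < n, s.iarr 5 j = candT (s.rarr 0) n i σ j) (hW : n * n ≤ W) :
    Runs W candSProg s (300 * (n * n)) fun s' =>
      s'.rvar 16 = candV (s.rarr 0) n i σ (s.rvar 14) ∧
      (∀ k < n, s'.iarr 4 k = 0 ∨ s'.iarr 4 k = 1) ∧
      s'.rvar 16 = ∑ k ∈ range n, (s'.iarr 4 k : ℝ) *
        ∑ j ∈ range n, (s.iarr 5 j : ℝ) * (s.rvar 14 * s.rarr 0 (k * n + j)) := by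
  classical
  have hnn : n ≤ n * n := Nat.le_mul_self n
  have hQ : ∀ k, s.rvar 14 * candQ (s.rarr 0) n i σ k =
      ∑ j ∈ range n, (s.iarr 5 j : ℝ) * (s.rvar 14 * s.rarr 0 (k * n + j)) := by
    intro k
    rw [candQ, mul_sum]
    refine sum_congr rfl fun j hj => ?_
    rw [hT j (mem_range.1 hj)]
    ring
  unfold candSProg
  apply Runs.time
  · apply Runs.rset_seq (by simp)
    apply Runs.forTo (N := n) (hN := by omega) (hi := by decide)
      (I := fun k s' => (s'.rvar 16 = ∑ q ∈ range k, if 0 < s.rvar 14 * candQ (s.rarr 0) n i σ q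
          then s.rvar 14 * candQ (s.rarr 0) n i σ q else 0) ∧
        ∀ q < k, s'.iarr 4 q = if 0 < s.rvar 14 * candQ (s.rarr 0) n i σ q then 1 else 0)
    · intro s' hA
      simp [hA.ivar 0 (by decide), hn]
    · simp
    · intro k s' hk hA hk' ⟨hI, hI'⟩
      have h0 := hA.ivar 0 (by decide)
      have h14 := hA.rvar 14 (by decide)
      have hd := hA.rarr 0 (by decide)
      have hT' := hA.iarr 5 (by decide)
      simp [hn] at h0 h14 hd hT'
      apply Runs.rset_seq (by simp)
      apply Runs.seq
      · apply Runs.forTo (N := n) (hN := by omega) (hi := by decide)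
          (I := fun j s' => s'.rvar 15 =
            ∑ j ∈ range j, s.rarr 0 (k * n + j) * candT (s.rarr 0) n i σ j)
          (Q := fun s' => s'.rvar 15 = candQ (s.rarr 0) n i σ k)
        · intro s₁ hA₁
          simp [hA₁.ivar 0 (by decide), h0]
        · simp
        · intro j s₁ hj hA₁ hj' hI₁
          have g0 := hA₁.ivar 0 (by decide)
          have g33 := hA₁.ivar 33 (by decide)
          have gd := hA₁.rarr 0 (by decide)
          have gT := hA₁.iarr 5 (by decide)
          simp [h0, hk', hd, hT'] at g0 g33 gd gT
          have := adr_lt hk hj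
          apply Runs.rset
          · simp [g0, g33, hj']; omega
          · simp [g0, g33, hj', gd, gT, hI₁, hT j hj, sum_range_succ]
        · exact fun s' h _ => h
      intro s₁ h₁ hA₁
      have g33 := hA₁.ivar 33 (by decide)
      have g14 := hA₁.rvar 14 (by decide)
      have g16 := hA₁.rvar 16 (by decide)
      have g4 := hA₁.iarr 4 (by decide)
      simp [hk', h14, hI] at g33 g14 g16 g4
      apply Runs.rset_seq (by simp)
      apply Runs.ite_max (by simp)
      · intro hb
        simp [h₁, g14] at hb
        apply Runs.istore_seq (by simp) (by simp; nlinarith)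
        apply Runs.rset (by simp)
        refine ⟨by simp [h₁, g16, g14, hb, sum_range_succ], fun q hq => ?_⟩
        by_cases hqj : q = k
        · simp [g33, hqj, hb]
        · simpa [g33, g4, Function.update_apply, hqj] using hI' q (by omega)
      · intro hb
        simp [h₁, g14] at hb
        apply Runs.istore (by simp) (by simp)
        refine ⟨by simp [g16, not_lt.2 hb, sum_range_succ], fun q hq => ?_⟩
        by_cases hqj : q = k
        · simp [g33, hqj, not_lt.2 hb]
        · simpa [g33, g4, Function.update_apply, hqj] using hI' q (by omega)
    · rintro s' ⟨h, h'⟩ _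
      refine ⟨by rw [h, candV], fun k hk => ?_, ?_⟩
      · rw [h' k hk]; split_ifs <;> simp
      · rw [h]
        refine sum_congr rfl fun k hk => ?_
        rw [h' k (mem_range.1 hk), ← hQ]
        split_ifs <;> simp
  · simp
    have : 1 ≤ n * n := Nat.mul_pos hn0 hn0
    linarith

/-- Test the candidate with the number `i₃₀`. -/
def candProg : Prog :=
  -- The candidate number encodes a position in the sample and, in its two lowest bits, the two
  -- signs.
  .iset 21 (.load 2 (.div (.var 30) (.lit 4))) ⨟
  .rset 13 (.sub (.ofNat (.lit 1)) (.mul (.ofNat (.lit 2)) (.ofNat (.mod (.var 30) (.lit 2))))) ⨟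
  .rset 14 (.sub (.ofNat (.lit 1))
    (.mul (.ofNat (.lit 2)) (.ofNat (.mod (.div (.var 30) (.lit 2)) (.lit 2))))) ⨟
  candZProg ⨟ candTProg ⨟ candSProg ⨟
  .ite (.rle (.mul (.var 1) (.mul (.ofNat (.var 0)) (.ofNat (.var 0)))) (.var 16))
    (.iset 9 (.lit 1)) .skip

/-- The state after the search for a cut of weight `v` among the first `m` candidates. -/
def Searched (d : ℕ → ℝ) (L : ℕ → ℕ) (n : ℕ) (v : ℝ) (m : ℕ) (s : State) : Prop :=
  (s.ivar 9 = 0 ∧ ∀ q < m, candV d n (L (q / 4)) (paritySign q) (paritySign (q / 2)) < v) ∨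
  (s.ivar 9 = 1 ∧ GoodCut d n (s.rvar 14) (s.iarr 4) (s.iarr 5) v)

theorem runs_cand {W n q : ℕ} {s : State} (hn : s.ivar 0 = n) (hn0 : 0 < n) (hq : s.ivar 30 = q)
    (hL : s.iarr 2 (q / 4) < n) (h9 : s.ivar 9 = 0) (hW : n * n ≤ W) (hW4 : 4 ≤ W)
    (hS : Searched (s.rarr 0) (s.iarr 2) n (s.rvar 1 * (n * n)) q s) :
    Runs W candProg s (700 * (n * n)) fun s' =>
      Searched (s.rarr 0) (s.iarr 2) n (s.rvar 1 * (n * n)) (q + 1) s' := by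
  unfold candProg
  apply Runs.time
  · apply Runs.iset_seq
    · simp; omega
    apply Runs.rset_seq
    · simp; omega
    apply Runs.rset_seq
    · simp; omega
    apply Runs.seq
    · exact runs_candZ (n := n) (i := s.iarr 2 (q / 4)) (by simp [hn]) (by simp [hq]) hL hW
    intro s₁ h₁ hA₁
    have f0 := hA₁.ivar 0 (by decide)
    have f9 := hA₁.ivar 9 (by decide)
    have f13 := hA₁.rvar 13 (by decide)
    have f14 := hA₁.rvar 14 (by decide)
    have f1 := hA₁.rvar 1 (by decide)
    have fd := hA₁.rarr 0 (by decide)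
    simp [hn, hq, h9] at f0 f9 f13 f14 f1 fd h₁
    apply Runs.seq
    · exact runs_candT (n := n) (i := s.iarr 2 (q / 4)) f0 hn0 (by simpa [fd] using h₁) hW
    intro s₂ h₂ hA₂
    have g0 := hA₂.ivar 0 (by decide)
    have g9 := hA₂.ivar 9 (by decide)
    have g14 := hA₂.rvar 14 (by decide)
    have g1 := hA₂.rvar 1 (by decide)
    have gd := hA₂.rarr 0 (by decide)
    rw [f0] at g0; rw [f9] at g9; rw [f14] at g14; rw [f1] at g1; rw [fd] at gd
    rw [fd, f13] at h₂
    apply Runs.seq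
    · exact runs_candS (n := n) (i := s.iarr 2 (q / 4)) g0 hn0 (by rw [gd]; exact h₂) hW
    rintro s₃ ⟨h₃, h₃', h₃''⟩ hA₃
    have e0 := hA₃.ivar 0 (by decide)
    have e9 := hA₃.ivar 9 (by decide)
    have e14 := hA₃.rvar 14 (by decide)
    have e1 := hA₃.rvar 1 (by decide)
    have e5 := hA₃.iarr 5 (by decide)
    rw [g0] at e0; rw [g9] at e9; rw [g1] at e1
    apply Runs.ite_max (by simp)
    · intro hb
      simp [e1, e0] at hb
      apply Runs.iset (by simp; omega)
      refine .inr ⟨by simp, h₃', fun j hj => ?_, ?_, ?_⟩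
      · simp only [State.setI_iarr, e5]
        rw [h₂ j hj, candT]
        split_ifs <;> simp
      · simp only [State.setI_rvar, e14, g14]
        have := paritySign_eq (q / 2)
        simpa [paritySign] using this
      · simp only [State.setI_rvar, State.setI_iarr, e14, e5]
        rw [gd] at h₃''
        rw [← h₃'']
        exact hb
    · intro hb
      simp [e1, e0] at hb
      apply Runs.skip
      refine .inl ⟨e9, fun q' hq' => ?_⟩
      rcases Nat.lt_succ_iff_lt_or_eq.1 hq' with h | rfl
      · rcases hS with ⟨-, h'⟩ | ⟨h', -⟩
        · exact h' q' h
        · omega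
      · rw [h₃, gd, g14] at hb
        simpa [paritySign] using hb
  · simp
    have : 1 ≤ n * n := Nat.mul_pos hn0 hn0
    omega

/-- Test all the candidates until one succeeds. -/
def searchProg : Prog :=
  .iset 9 (.lit 0) ⨟
  -- After a success the remaining candidates are skipped, so the cut and its sign in `r₁₄` survive.
  .forTo 30 (.mul (.lit 4) (.var 3)) (.ite (.ile (.var 9) (.lit 0)) candProg .skip)

theorem runs_search {W n M : ℕ} {s : State} (hn : s.ivar 0 = n) (hn0 : 0 < n) (hM : s.ivar 3 = M)
    (hM0 : 0 < M) (hL : ∀ p < M, s.iarr 2 p < n) (hW : n * n ≤ W) (hWM : 4 * M ≤ W) :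
    Runs W searchProg s (4000 * (M * (n * n))) fun s' =>
      Searched (s.rarr 0) (s.iarr 2) n (s.rvar 1 * (n * n)) (4 * M) s' := by
  unfold searchProg
  apply Runs.time
  · apply Runs.iset_seq (by simp)
    apply Runs.forTo (N := 4 * M) (hN := hWM) (hi := by decide)
      (I := fun q s' => Searched (s.rarr 0) (s.iarr 2) n (s.rvar 1 * (n * n)) q s')
    · intro s' hA
      simp [hA.ivar 3 (by decide), hM]
      omega
    · exact .inl (by simp)
    · intro q s' hq hA hq' hI
      have h0 := hA.ivar 0 (by decide)
      have h1 := hA.rvar 1 (by decide)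
      have hd := hA.rarr 0 (by decide)
      have hl := hA.iarr 2 (by decide)
      simp [hn] at h0 h1 hd hl
      apply Runs.ite_max (by simp)
      · intro hb
        simp at hb
        refine (runs_cand (n := n) (q := q) h0 hn0 hq' (by rw [hl]; exact hL _ (by omega)) hb hW
          (by omega) (by rwa [h1, hd, hl])).mono le_rfl fun s₁ h₁ _ => ?_
        rw [h1, hd, hl] at h₁
        simpa [Searched] using h₁
      · intro hb
        simp at hb
        apply Runs.skip
        rcases hI with ⟨h, -⟩ | h
        · omega
        · exact .inr (by simpa using h)
    · exact fun s' h _ => h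
  · simp
    have h1 : 1 ≤ n * n := Nat.mul_pos hn0 hn0
    have h2 : 1 ≤ M * (n * n) := Nat.mul_pos hM0 h1
    rw [max_eq_left (by omega)]
    have h3 : M ≤ M * (n * n) := Nat.le_mul_of_pos_right _ h1
    have e : 4 * M * (4 + 700 * (n * n) + 3 + 8) = 2800 * (M * (n * n)) + 60 * M := by ring
    omega

/-! ### Pruning a cut, with rows and columns treated by the same code. -/

/-- The address of the entry in line `x` and position `y`, where lines are rows or columns. -/
def lineAdr (b : Bool) (n x y : ℕ) : ℕ := if b then x * n + y else y * n + x

/-- The address of the entry in line `i₃₃` and position `i₃₄`. -/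
def lineExp (b : Bool) : IExp := if b then adr 33 34 else adr 34 33

@[simp] theorem lineExp_val (b : Bool) (s : State) :
    (lineExp b).val s = lineAdr b (s.ivar 0) (s.ivar 33) (s.ivar 34) := by
  cases b <;> rfl

@[simp] theorem lineExp_cost (b : Bool) : (lineExp b).cost = 5 := by cases b <;> rfl

theorem lineExp_safe {b : Bool} {W n x y : ℕ} {s : State} (hn : s.ivar 0 = n) (hx : s.ivar 33 = x)
    (hy : s.ivar 34 = y) (hxn : x < n) (hyn : y < n) (hW : n * n ≤ W) : (lineExp b).Safe W s := by
  have h1 := adr_lt hxn hyn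
  have h2 := adr_lt hyn hxn
  cases b <;> simp [lineExp, hn, hx, hy] <;> omega

/-- The array of the incidence vector of the lines. -/
def incArr (b : Bool) : ℕ := if b then 4 else 5

/-- The array of the line sums. -/
def sumArr (b : Bool) : ℕ := if b then 5 else 6

/-- The gain of the entry in line `i₃₃` and position `i₃₄`. -/
def gainExp (b : Bool) : RExp :=
  .sub (.mul (.var 14) (.load 0 (lineExp b))) (.div (.var 1) (.ofNat (.lit 2)))

/-- The gain of the entry in line `x` and position `y`. -/
noncomputable def gain (d : ℕ → ℝ) (σ c : ℝ) (n : ℕ) (b : Bool) (x y : ℕ) : ℝ :=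
  -- For a sign `σ`, this is `1 / (2 c)` times the decrease of the squared entry when `σ c` is
  -- subtracted and `c ≠ 0`.
  σ * d (lineAdr b n x y) - c / 2

theorem gain_not (d : ℕ → ℝ) (σ c : ℝ) (n : ℕ) (b : Bool) (x y : ℕ) :
    gain d σ c n (!b) x y = gain d σ c n b y x := by
  cases b <;> rfl

@[simp] theorem gainExp_val (b : Bool) (s : State) : (gainExp b).val s =
    gain (s.rarr 0) (s.rvar 14) (s.rvar 1) (s.ivar 0) b (s.ivar 33) (s.ivar 34) := by
  simp [gainExp, gain]

@[simp] theorem gainExp_cost (b : Bool) : (gainExp b).cost = 13 := by simp [gainExp]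

/-- Compute the line sums. -/
def sumProg (b : Bool) : Prog :=
  .forTo 33 (.var 0) (.rset 15 (.ofNat (.lit 0)) ⨟
    .forTo 34 (.var 0)
      (.rset 15 (.add (.var 15) (.mul (.ofNat (.load (incArr !b) (.var 34))) (gainExp b)))) ⨟
    .rstore (sumArr b) (.var 33) (.var 15))

theorem runs_sum {W n : ℕ} {s : State} (b : Bool) (hn : s.ivar 0 = n) (hn0 : 0 < n)
    (hW : n * n ≤ W) (hW2 : 2 ≤ W) :
    Runs W (sumProg b) s (100 * (n * n)) fun s' => ∀ x < n, s'.rarr (sumArr b) x =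
      ∑ y ∈ range n, (s.iarr (incArr !b) y : ℝ) * gain (s.rarr 0) (s.rvar 14) (s.rvar 1) n b x y := by
  have hnn : n ≤ n * n := Nat.le_mul_self n
  unfold sumProg
  apply Runs.time
  · apply Runs.forTo (N := n) (hN := by omega) (hi := by cases b <;> decide)
      (I := fun k s' => ∀ x < k, s'.rarr (sumArr b) x = ∑ y ∈ range n,
        (s.iarr (incArr !b) y : ℝ) * gain (s.rarr 0) (s.rvar 14) (s.rvar 1) n b x y)
    · intro s' hA
      simp [hA.ivar 0 (by cases b <;> decide), hn]
    · simp
    · intro k s' hk hA hk' hI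
      have h0 := hA.ivar 0 (by cases b <;> decide)
      have h14 := hA.rvar 14 (by cases b <;> decide)
      have h1 := hA.rvar 1 (by cases b <;> decide)
      have hd := hA.rarr 0 (by cases b <;> decide)
      have hT := hA.iarr (incArr !b) (by cases b <;> decide)
      rw [hn] at h0
      apply Runs.rset_seq (by simp)
      apply Runs.seq
      · apply Runs.forTo (N := n) (hN := by omega) (hi := by cases b <;> decide)
          (I := fun j s' => s'.rvar 15 = ∑ y ∈ range j, (s.iarr (incArr !b) y : ℝ) *
            gain (s.rarr 0) (s.rvar 14) (s.rvar 1) n b k y)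
          (Q := fun s' => s'.rvar 15 = ∑ y ∈ range n, (s.iarr (incArr !b) y : ℝ) *
            gain (s.rarr 0) (s.rvar 14) (s.rvar 1) n b k y)
        · intro s₁ hA₁
          simp [hA₁.ivar 0 (by cases b <;> decide), h0]
        · simp
        · intro j s₁ hj hA₁ hj' hI₁
          have g0 := hA₁.ivar 0 (by cases b <;> decide)
          have g33 := hA₁.ivar 33 (by cases b <;> decide)
          have g14 := hA₁.rvar 14 (by cases b <;> decide)
          have g1 := hA₁.rvar 1 (by cases b <;> decide)
          have gd := hA₁.rarr 0 (by cases b <;> decide)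
          have gT := hA₁.iarr (incArr !b) (by cases b <;> decide)
          simp [h0, hk', h14, h1, hd, hT] at g0 g33 g14 g1 gd gT
          apply Runs.rset
          · simp [gainExp, lineExp_safe g0 g33 hj' hk hj hW, hW2]
          · simp [g0, g33, hj', gd, gT, g14, g1, hI₁, sum_range_succ]
        · exact fun s' h _ => h
      intro s₁ h₁ hA₁
      have g33 := hA₁.ivar 33 (by cases b <;> decide)
      have g5 := hA₁.rarr (sumArr b) (by cases b <;> decide)
      simp [hk'] at g33 g5
      apply Runs.rstore (by simp) (by simp)
      intro q hq
      by_cases hqk : q = k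
      · simp [g33, hqk, h₁]
      · simpa [g33, g5, Function.update_apply, hqk] using hI q (by omega)
    · exact fun s' h _ => h
  · simp
    have : 1 ≤ n * n := Nat.mul_pos hn0 hn0
    linarith

/-- Find a line of the cut with a negative sum. -/
def scanProg (b : Bool) : Prog :=
  -- `i₃₇` holds the found line plus one, so that 0 means that there is none.
  .iset 37 (.lit 0) ⨟
  .forTo 36 (.var 0) (.ite (.and (.not (.ile (.load (incArr b) (.var 36)) (.lit 0)))
    (.not (.rle (.ofNat (.lit 0)) (.load (sumArr b) (.var 36)))))
    (.iset 37 (.add (.var 36) (.lit 1))) .skip)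

theorem runs_scan {W n : ℕ} {s : State} (b : Bool) (hn : s.ivar 0 = n) (hn0 : 0 < n)
    (hW : n * n ≤ W) :
    Runs W (scanProg b) s (100 * n) fun s' =>
      (s'.ivar 37 = 0 ∧ ∀ x < n, 0 < s.iarr (incArr b) x → 0 ≤ s.rarr (sumArr b) x) ∨
      ∃ x < n, s'.ivar 37 = x + 1 ∧ 0 < s.iarr (incArr b) x ∧ s.rarr (sumArr b) x < 0 := by
  have hnn : n ≤ n * n := Nat.le_mul_self n
  unfold scanProg
  apply Runs.time
  · apply Runs.iset_seq (by simp)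
    apply Runs.forTo (N := n) (hN := by omega) (hi := by cases b <;> decide)
      (I := fun k s' => (s'.ivar 37 = 0 ∧ ∀ x < k, 0 < s.iarr (incArr b) x →
        0 ≤ s.rarr (sumArr b) x) ∨
        ∃ x < n, s'.ivar 37 = x + 1 ∧ 0 < s.iarr (incArr b) x ∧ s.rarr (sumArr b) x < 0)
    · intro s' hA
      simp [hA.ivar 0 (by cases b <;> decide), hn]
    · simp
    · intro k s' hk hA hk' hI
      have hd := hA.rarr (sumArr b) (by cases b <;> decide)
      have hT := hA.iarr (incArr b) (by cases b <;> decide)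
      simp at hd hT
      apply Runs.ite_max (by simp)
      · intro hb
        simp [hd, hT, hk'] at hb
        apply Runs.iset (by simp [hk']; omega)
        exact .inr ⟨k, hk, by simp [hk'], Nat.pos_of_ne_zero hb.1, hb.2⟩
      · intro hb
        simp [hd, hT, hk'] at hb
        apply Runs.skip
        rcases hI with ⟨h, h'⟩ | h
        · refine .inl ⟨by simpa using h, fun x hx hx' => ?_⟩
          rcases Nat.lt_succ_iff_lt_or_eq.1 hx with h'' | rfl
          · exact h' x h'' hx'
          · exact hb hx'.ne'
        · exact .inr (by simpa using h)
    · exact fun s' h _ => h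
  · simp
    linarith

/-- Delete the line that the scan has found. -/
def dropProg (b : Bool) : Prog :=
  .ite (.ile (.var 37) (.lit 0)) .skip
    (.iset 33 (.sub (.var 37) (.lit 1)) ⨟ .istore (incArr b) (.var 33) (.lit 0) ⨟
      .forTo 34 (.var 0) (.rstore (sumArr !b) (.var 34)
        (.sub (.load (sumArr !b) (.var 34)) (gainExp b))))

theorem runs_drop {W n x : ℕ} {s : State} (b : Bool) (hn : s.ivar 0 = n) (hn0 : 0 < n)
    (hx : s.ivar 37 = x + 1) (hxn : x < n) (hW : n * n ≤ W) (hW2 : 2 ≤ W) :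
    Runs W (dropProg b) s (100 * n) fun s' =>
      s'.iarr (incArr b) = Function.update (s.iarr (incArr b)) x 0 ∧
      s'.rarr (sumArr b) = s.rarr (sumArr b) ∧
      ∀ y < n, s'.rarr (sumArr !b) y = s.rarr (sumArr !b) y -
        gain (s.rarr 0) (s.rvar 14) (s.rvar 1) n b x y := by
  have hnn : n ≤ n * n := Nat.le_mul_self n
  unfold dropProg
  apply Runs.time
  · apply Runs.ite_max (by simp)
    · intro hb
      apply Runs.skip
      simp [hx] at hb
    intro _
    apply Runs.iset_seq (by simp; omega)
    apply Runs.istore_seq (by simp) (by simp)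
    apply Runs.forTo (N := n) (hN := by omega) (hi := by cases b <;> decide)
      (I := fun k s' => (∀ y < k, s'.rarr (sumArr !b) y = s.rarr (sumArr !b) y -
        gain (s.rarr 0) (s.rvar 14) (s.rvar 1) n b x y) ∧
        ∀ y, k ≤ y → s'.rarr (sumArr !b) y = s.rarr (sumArr !b) y)
    · intro s' hA
      simp [hA.ivar 0 (by cases b <;> decide), hn]
    · simp
    · intro k s' hk hA hk' hI
      have h0 := hA.ivar 0 (by cases b <;> decide)
      have h33 := hA.ivar 33 (by cases b <;> decide)
      have h14 := hA.rvar 14 (by cases b <;> decide)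
      have h1 := hA.rvar 1 (by cases b <;> decide)
      have hd := hA.rarr 0 (by cases b <;> decide)
      simp [hn, hx] at h0 h33 h14 h1 hd
      apply Runs.rstore (by simp)
      · simp [gainExp, lineExp_safe h0 h33 hk' hxn hk hW, hW2]
      refine ⟨fun y hy => ?_, fun y hy => ?_⟩
      · by_cases hyk : y = k
        · subst hyk
          simp [hk', h0, h33, h14, h1, hd, hI.2 y le_rfl]
        · simpa [hk', Function.update_apply, hyk] using hI.1 y (by omega)
      · simpa [hk', Function.update_apply, show y ≠ k by omega] using hI.2 y (by omega)
    · intro s' h hA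
      have h1 := hA.rarr (sumArr b) (by cases b <;> decide)
      have h2 := hA.iarr (incArr b) (by cases b <;> decide)
      exact ⟨by simpa [hx] using h2, by simpa using h1, h.1⟩
  · simp
    omega

/-- `X`, `Y` are incidence vectors, `rx`, `ry` the line sums of the gains `h` over the cut, and the
cut has total gain at least `F`. -/
structure PruneInv (h : ℕ → ℕ → ℝ) (n : ℕ) (X Y : ℕ → ℕ) (rx ry : ℕ → ℝ) (F : ℝ) : Prop where
  left : ∀ x < n, X x = 0 ∨ X x = 1
  right : ∀ y < n, Y y = 0 ∨ Y y = 1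
  sum_left : ∀ x < n, rx x = ∑ y ∈ range n, (Y y : ℝ) * h x y
  sum_right : ∀ y < n, ry y = ∑ x ∈ range n, (X x : ℝ) * h x y
  le : F ≤ ∑ x ∈ range n, (X x : ℝ) * ∑ y ∈ range n, (Y y : ℝ) * h x y

theorem PruneInv.symm {h : ℕ → ℕ → ℝ} {n : ℕ} {X Y : ℕ → ℕ} {rx ry : ℕ → ℝ} {F : ℝ}
    (H : PruneInv h n X Y rx ry F) : PruneInv (fun y x => h x y) n Y X ry rx F := by
  refine ⟨H.right, H.left, H.sum_right, H.sum_left, H.le.trans_eq ?_⟩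
  simp only [mul_sum]
  rw [sum_comm]
  exact sum_congr rfl fun _ _ => sum_congr rfl fun _ _ => by ring

theorem sum_update_zero_mul {X : ℕ → ℕ} {n x : ℕ} (hx : x < n) (h1 : X x = 1) (g : ℕ → ℝ) :
    ∑ k ∈ range n, (Function.update X x 0 k : ℝ) * g k = ∑ k ∈ range n, (X k : ℝ) * g k - g x := by
  have h : ∑ k ∈ range n, (X k : ℝ) * g k -
      ∑ k ∈ range n, (Function.update X x 0 k : ℝ) * g k = g x := by
    rw [← sum_sub_distrib, sum_eq_single x]
    · simp [h1]
    · intro k _ hk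
      simp [hk]
    · intro h
      exact (h (mem_range.2 hx)).elim
  linarith

/-- Deleting a line removes exactly its negative sum from the total gain, which therefore rises, and
one entry from each crossing sum. -/
theorem PruneInv.drop {h : ℕ → ℕ → ℝ} {n : ℕ} {X Y : ℕ → ℕ} {rx ry ry' : ℕ → ℝ} {F : ℝ}
    (H : PruneInv h n X Y rx ry F) {x : ℕ} (hx : x < n) (hX : 0 < X x) (hr : rx x < 0)
    (hry : ∀ y < n, ry' y = ry y - h x y) :
    PruneInv h n (Function.update X x 0) Y rx ry' F := by
  have h1 : X x = 1 := by rcases H.left x hx with h | h <;> omega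
  refine ⟨fun k hk => ?_, H.right, H.sum_left, fun y hy => ?_, ?_⟩
  · by_cases hkx : k = x
    · simp [hkx]
    · simpa [hkx] using H.left k hk
  · rw [hry y hy, H.sum_right y hy, sum_update_zero_mul hx h1 fun k => h k y]
  · rw [sum_update_zero_mul hx h1 fun k => ∑ y ∈ range n, (Y y : ℝ) * h k y, ← H.sum_left x hx]
    linarith [H.le]

/-- The size of the cut. -/
def cutSize (n : ℕ) (s : State) : ℕ := ∑ x ∈ range n, s.iarr 4 x + ∑ x ∈ range n, s.iarr 5 x

theorem cutSize_eq (b : Bool) (n : ℕ) (s : State) : cutSize n s =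
    ∑ x ∈ range n, s.iarr (incArr b) x + ∑ x ∈ range n, s.iarr (incArr !b) x := by
  cases b
  · exact add_comm _ _
  · rfl

/-- No line has a negative sum. -/
def Stable (b : Bool) (n : ℕ) (s : State) : Prop :=
  ∀ x < n, 0 < s.iarr (incArr b) x → 0 ≤ s.rarr (sumArr b) x

/-- The invariant of the pruning procedure. -/
def Pruning (b : Bool) (d : ℕ → ℝ) (σ c : ℝ) (n : ℕ) (F : ℝ) (s : State) : Prop :=
  PruneInv (gain d σ c n b) n (s.iarr (incArr b)) (s.iarr (incArr !b)) (s.rarr (sumArr b))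
    (s.rarr (sumArr !b)) F

theorem Pruning.symm {b : Bool} {d : ℕ → ℝ} {σ c : ℝ} {n : ℕ} {F : ℝ} {s : State}
    (h : Pruning b d σ c n F s) : Pruning (!b) d σ c n F s := by
  have e : gain d σ c n (!b) = fun y x => gain d σ c n b x y := by
    funext y x
    exact gain_not ..
  unfold Pruning
  rw [Bool.not_not, e]
  exact PruneInv.symm h

/-- The two memories hold the same cut. -/
def SameCut (s s' : State) : Prop :=
  ∀ b, s'.iarr (incArr b) = s.iarr (incArr b) ∧ s'.rarr (sumArr b) = s.rarr (sumArr b)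

theorem SameCut.cutSize_eq {s s' : State} (h : SameCut s s') (n : ℕ) :
    cutSize n s' = cutSize n s := by
  have e4 : s'.iarr 4 = s.iarr 4 := (h true).1
  have e5 : s'.iarr 5 = s.iarr 5 := (h false).1
  rw [cutSize, cutSize, e4, e5]

/-- Delete a line with a negative sum, if there is one. -/
def pruneStep (b : Bool) : Prog := scanProg b ⨟ dropProg b

/-- Updating the crossing sums instead of recomputing them keeps a step linear in `n`. A step that
deletes nothing certifies stability in its direction. -/
theorem runs_pruneStep {W n : ℕ} {s : State} {F : ℝ} (b : Bool) (hn : s.ivar 0 = n) (hn0 : 0 < n)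
    (hW : n * n ≤ W) (hW2 : 2 ≤ W) (hP : Pruning b (s.rarr 0) (s.rvar 14) (s.rvar 1) n F s) :
    Runs W (pruneStep b) s (200 * n) fun s' =>
      Pruning b (s.rarr 0) (s.rvar 14) (s.rvar 1) n F s' ∧
      (SameCut s s' ∧ Stable b n s ∨ ¬ Stable b n s ∧ cutSize n s' + 1 ≤ cutSize n s) := by
  unfold pruneStep
  refine ((runs_scan b hn hn0 hW).seq (T' := 100 * n) fun s₁ h₁ hA₁ => ?_).time (by omega)
  have f0 := hA₁.ivar 0 (by cases b <;> decide)
  have f14 := hA₁.rvar 14 (by cases b <;> decide)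
  have f1 := hA₁.rvar 1 (by cases b <;> decide)
  have fd := hA₁.rarr 0 (by cases b <;> decide)
  have fX := hA₁.iarr (incArr b) (by cases b <;> decide)
  have fY := hA₁.iarr (incArr !b) (by cases b <;> decide)
  have fx := hA₁.rarr (sumArr b) (by cases b <;> decide)
  have fy := hA₁.rarr (sumArr !b) (by cases b <;> decide)
  rcases h₁ with ⟨h37, hst⟩ | ⟨x, hx, h37, hX, hr⟩
  · unfold dropProg
    refine (Runs.ite (T := 1) (by simp) (fun _ => Runs.skip ?_) fun hb => ?_).time (by simp; omega)
    · refine ⟨?_, .inl ⟨fun b' => ?_, hst⟩⟩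
      · rw [Pruning, fX, fY, fx, fy]
        exact hP
      · by_cases hbb : b' = b
        · subst hbb; exact ⟨fX, fx⟩
        · obtain rfl : b' = !b := by cases b <;> cases b' <;> simp_all
          exact ⟨fY, fy⟩
    · simp [h37] at hb
  · refine (runs_drop b (f0.trans hn) hn0 h37 hx hW hW2).mono le_rfl fun s₂ h₂ hA₂ => ?_
    obtain ⟨h₂, h₂', h₂''⟩ := h₂
    have gY := hA₂.iarr (incArr !b) (by cases b <;> decide)
    rw [fX] at h₂
    rw [fx] at h₂'
    rw [fy, fd, f14, f1] at h₂''
    rw [fY] at gY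
    refine ⟨?_, .inr ⟨fun h => ?_, ?_⟩⟩
    · rw [Pruning, h₂, gY, h₂']
      exact PruneInv.drop hP hx hX hr h₂''
    · exact absurd (h x hx hX) (not_le.2 hr)
    · have h1 : s.iarr (incArr b) x = 1 := by rcases hP.left x hx with h | h <;> omega
      rw [cutSize_eq b, cutSize_eq b, h₂, gY]
      have := sum_update_zero_mul hx h1 fun _ => 1
      simp only [mul_one] at this
      have h2 : ∑ k ∈ range n, Function.update (s.iarr (incArr b)) x 0 k + 1 =
          ∑ k ∈ range n, s.iarr (incArr b) k := by
        have : ((∑ k ∈ range n, Function.update (s.iarr (incArr b)) x 0 k + 1 : ℕ) : ℝ) =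
          ((∑ k ∈ range n, s.iarr (incArr b) k : ℕ) : ℝ) := by
          push_cast
          linarith
        exact_mod_cast this
      omega

/-- Delete rows and columns with negative sums until there are none. -/
def pruneProg : Prog :=
  sumProg true ⨟ sumProg false ⨟
  .forTo 35 (.add (.var 0) (.var 0)) (pruneStep true ⨟ pruneStep false)

theorem runs_prune {W n : ℕ} {s : State} {F : ℝ} (hn : s.ivar 0 = n) (hn0 : 0 < n)
    (hW : n * n ≤ W) (hW2 : 2 * n ≤ W)
    (hS : ∀ k < n, s.iarr 4 k = 0 ∨ s.iarr 4 k = 1) (hT : ∀ k < n, s.iarr 5 k = 0 ∨ s.iarr 5 k = 1)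
    (hF : F ≤ ∑ x ∈ range n, (s.iarr 4 x : ℝ) * ∑ y ∈ range n, (s.iarr 5 y : ℝ) *
      gain (s.rarr 0) (s.rvar 14) (s.rvar 1) n true x y) :
    Runs W pruneProg s (2000 * (n * n)) fun s' =>
      Pruning true (s.rarr 0) (s.rvar 14) (s.rvar 1) n F s' ∧
      Stable true n s' ∧ Stable false n s' := by
  have hnn : n ≤ n * n := Nat.le_mul_self n
  unfold pruneProg
  apply Runs.time
  · apply Runs.seq (runs_sum true hn hn0 hW (by omega))
    intro s₁ h₁ hA₁
    have f0 := hA₁.ivar 0 (by decide)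
    have f14 := hA₁.rvar 14 (by decide)
    have f1 := hA₁.rvar 1 (by decide)
    have fd := hA₁.rarr 0 (by decide)
    have f4 := hA₁.iarr 4 (by decide)
    have f5 := hA₁.iarr 5 (by decide)
    apply Runs.seq (runs_sum false (f0.trans hn) hn0 hW (by omega))
    intro s₂ h₂ hA₂
    have g0 := hA₂.ivar 0 (by decide)
    have g14 := hA₂.rvar 14 (by decide)
    have g1 := hA₂.rvar 1 (by decide)
    have gd := hA₂.rarr 0 (by decide)
    have g4 := hA₂.iarr 4 (by decide)
    have g5 := hA₂.iarr 5 (by decide)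
    have gr := hA₂.rarr 5 (by decide)
    rw [f0, hn] at g0; rw [f14] at g14; rw [f1] at g1; rw [fd] at gd; rw [f4] at g4; rw [f5] at g5
    have hP : Pruning true (s.rarr 0) (s.rvar 14) (s.rvar 1) n F s₂ := by
      refine ⟨fun k hk => ?_, fun k hk => ?_, fun x hx => ?_, fun y hy => ?_, ?_⟩
      · change s₂.iarr 4 k = 0 ∨ s₂.iarr 4 k = 1
        rw [g4]; exact hS k hk
      · change s₂.iarr 5 k = 0 ∨ s₂.iarr 5 k = 1
        rw [g5]; exact hT k hk
      · change s₂.rarr 5 x = ∑ y ∈ range n, (s₂.iarr 5 y : ℝ) * _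
        rw [gr, g5]; exact h₁ x hx
      · change s₂.rarr 6 y = ∑ x ∈ range n, (s₂.iarr 4 x : ℝ) * _
        have := h₂ y hy
        rw [fd, f14, f1] at this
        rw [g4, ← f4]
        exact this
      · change F ≤ ∑ x ∈ range n, (s₂.iarr 4 x : ℝ) * ∑ y ∈ range n, (s₂.iarr 5 y : ℝ) * _
        rw [g4, g5]; exact hF
    -- A cut has at most `2 n` lines. A pass over both directions deletes a line or shows that the
    -- cut is stable, so after `2 n` passes it is stable or empty, hence stable.
    apply Runs.forTo (N := n + n) (hN := by omega) (hi := by decide)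
      (I := fun k s' => Pruning true (s.rarr 0) (s.rvar 14) (s.rvar 1) n F s' ∧
        ((Stable true n s' ∧ Stable false n s') ∨ cutSize n s' + k ≤ n + n))
    · intro s' hA
      have h0 := hA.ivar 0 (by decide)
      simp [h0, g0]
      omega
    · refine ⟨hP, .inr ?_⟩
      have hle : ∀ X : ℕ → ℕ, (∀ k < n, X k = 0 ∨ X k = 1) → ∑ k ∈ range n, X k ≤ n := by
        intro X hX
        calc ∑ k ∈ range n, X k ≤ ∑ _k ∈ range n, 1 :=
              sum_le_sum fun k hk => by rcases hX k (mem_range.1 hk) with h | h <;> omega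
          _ = n := by simp
      change ∑ x ∈ range n, s₂.iarr 4 x + ∑ x ∈ range n, s₂.iarr 5 x + 0 ≤ n + n
      rw [add_zero]
      exact add_le_add (hle _ hP.left) (hle _ hP.right)
    · intro k s' hk hA hk' ⟨hI, hI'⟩
      have h0 := hA.ivar 0 (by decide)
      have h14 := hA.rvar 14 (by decide)
      have h1 := hA.rvar 1 (by decide)
      have hd := hA.rarr 0 (by decide)
      rw [g0] at h0; rw [g14] at h14; rw [g1] at h1; rw [gd] at hd
      apply Runs.seq
      · exact runs_pruneStep (F := F) true h0 hn0 hW (by omega) (by rwa [hd, h14, h1])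
      rintro s₃ ⟨h₃, h₃'⟩ hA₃
      have e0 := hA₃.ivar 0 (by decide)
      have e14 := hA₃.rvar 14 (by decide)
      have e1 := hA₃.rvar 1 (by decide)
      have ed := hA₃.rarr 0 (by decide)
      rw [h0] at e0; rw [h14] at e14; rw [h1] at e1; rw [hd] at ed
      rw [hd, h14, h1] at h₃
      refine (runs_pruneStep (F := F) false e0 hn0 hW (by omega)
        (by rw [ed, e14, e1]; exact h₃.symm)).mono le_rfl ?_
      rintro s₄ ⟨h₄, h₄'⟩ hA₄
      rw [ed, e14, e1] at h₄
      refine ⟨h₄.symm, ?_⟩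
      change (Stable true n s₄ ∧ Stable false n s₄) ∨ cutSize n s₄ + (k + 1) ≤ n + n
      rcases h₃' with ⟨hsame, hst⟩ | ⟨hst, hlt⟩
      · have hst₃ : Stable true n s₃ := by
          intro x hx; rw [(hsame true).1, (hsame true).2]; exact hst x hx
        rcases h₄' with ⟨hsame₄, hst₄⟩ | ⟨hst₄, hlt₄⟩
        · left
          constructor
          · intro x hx; rw [(hsame₄ true).1, (hsame₄ true).2]; exact hst₃ x hx
          · intro x hx; rw [(hsame₄ false).1, (hsame₄ false).2]; exact hst₄ x hx
        · right
          have hcs := hsame.cutSize_eq n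
          rcases hI' with ⟨-, hI'⟩ | hI'
          · refine absurd (fun x hx => ?_) hst₄
            rw [(hsame false).1, (hsame false).2]; exact hI' x hx
          · omega
      · right
        have hcs : cutSize n s₄ ≤ cutSize n s₃ := by
          rcases h₄' with ⟨hsame₄, -⟩ | ⟨-, hlt₄⟩
          · exact (hsame₄.cutSize_eq n).le
          · omega
        rcases hI' with ⟨hI', -⟩ | hI'
        · exact absurd hI' hst
        · omega
    · rintro s' ⟨h, h'⟩ _
      refine ⟨h, ?_⟩
      rcases h' with h' | h'
      · exact h'
      · have h0 : cutSize n s' = 0 := by omega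
        simp only [cutSize, add_eq_zero, sum_eq_zero_iff, mem_range] at h0
        exact ⟨fun x hx hx' => absurd (h0.1 x hx) hx'.ne', fun x hx hx' =>
          absurd (h0.2 x hx) hx'.ne'⟩
  · simp
    have : 1 ≤ n * n := Nat.mul_pos hn0 hn0
    linarith

/-! ### Subtracting a cut, and the energy of the residual. -/

/-- Subtract the cut matrix from the residual, output it, and increase the counter `i₁`. -/
def updProg : Prog :=
  .forTo 33 (.mul (.var 0) (.var 0)) (.rstore 0 (.var 33) (.sub (.load 0 (.var 33))
    (.mul (.mul (.var 14) (.var 1)) (.mul (.ofNat (.load 4 (.div (.var 33) (.var 0))))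
      (.ofNat (.load 5 (.mod (.var 33) (.var 0)))))))) ⨟
  .forTo 33 (.var 0) (.istore 0 (adr 1 33) (.load 4 (.var 33)) ⨟
    .istore 1 (adr 1 33) (.load 5 (.var 33))) ⨟
  .rstore 1 (.var 1) (.mul (.var 14) (.var 1)) ⨟
  .iset 1 (.add (.var 1) (.lit 1))

theorem runs_upd {W n r : ℕ} {s : State} (hn : s.ivar 0 = n) (hn0 : 0 < n) (hr : s.ivar 1 = r)
    (hW : n * n ≤ W) (hWr : (r + 1) * n ≤ W) (hWr' : r + 1 ≤ W) :
    Runs W updProg s (200 * (n * n)) fun s' =>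
      s'.ivar 1 = r + 1 ∧
      (∀ a < n * n, s'.rarr 0 a = s.rarr 0 a -
        s.rvar 14 * s.rvar 1 * (s.iarr 4 (a / n) * s.iarr 5 (a % n))) ∧
      (∀ x < n, s'.iarr 0 (r * n + x) = s.iarr 4 x) ∧ (∀ a < r * n, s'.iarr 0 a = s.iarr 0 a) ∧
      (∀ x < n, s'.iarr 1 (r * n + x) = s.iarr 5 x) ∧ (∀ a < r * n, s'.iarr 1 a = s.iarr 1 a) ∧
      s'.rarr 1 r = s.rvar 14 * s.rvar 1 ∧ ∀ l < r, s'.rarr 1 l = s.rarr 1 l := by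
  have hnn : n ≤ n * n := Nat.le_mul_self n
  have hrn : (r + 1) * n = r * n + n := by ring
  unfold updProg
  apply Runs.time
  · apply Runs.seq
    · apply Runs.forTo (N := n * n) (hN := by omega) (hi := by decide)
        (I := fun k s' => (∀ a < k, s'.rarr 0 a = s.rarr 0 a -
          s.rvar 14 * s.rvar 1 * (s.iarr 4 (a / n) * s.iarr 5 (a % n))) ∧
          ∀ a, k ≤ a → s'.rarr 0 a = s.rarr 0 a)
        (Q := fun s' => ∀ a < n * n, s'.rarr 0 a = s.rarr 0 a -
          s.rvar 14 * s.rvar 1 * (s.iarr 4 (a / n) * s.iarr 5 (a % n)))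
      · intro s' hA
        simp [hA.ivar 0 (by decide), hn, hW]
      · simp
      · intro k s' hk hA hk' hI
        have h0 := hA.ivar 0 (by decide)
        have h14 := hA.rvar 14 (by decide)
        have h1 := hA.rvar 1 (by decide)
        have h4 := hA.iarr 4 (by decide)
        have h5 := hA.iarr 5 (by decide)
        rw [hn] at h0
        apply Runs.rstore (by simp)
        · simp [h0]; omega
        refine ⟨fun a ha => ?_, fun a ha => ?_⟩
        · by_cases hak : a = k
          · subst hak
            simp [hk', h0, h14, h1, h4, h5, hI.2 a le_rfl]
          · simpa [hk', Function.update_apply, hak] using hI.1 a (by omega)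
        · simpa [hk', Function.update_apply, show a ≠ k by omega] using hI.2 a (by omega)
      · exact fun s' h _ => h.1
    intro s₁ h₁ hA₁
    have f0 := hA₁.ivar 0 (by decide)
    have f1 := hA₁.ivar 1 (by decide)
    have f14 := hA₁.rvar 14 (by decide)
    have fc := hA₁.rvar 1 (by decide)
    have f4 := hA₁.iarr 4 (by decide)
    have f5 := hA₁.iarr 5 (by decide)
    have fo0 := hA₁.iarr 0 (by decide)
    have fo1 := hA₁.iarr 1 (by decide)
    have foc := hA₁.rarr 1 (by decide)
    rw [hn] at f0; rw [hr] at f1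
    apply Runs.seq
    · apply Runs.forTo (N := n) (hN := by omega) (hi := by decide)
        (I := fun k s' => (∀ x < k, s'.iarr 0 (r * n + x) = s.iarr 4 x) ∧
          (∀ a < r * n, s'.iarr 0 a = s.iarr 0 a) ∧
          (∀ x < k, s'.iarr 1 (r * n + x) = s.iarr 5 x) ∧ (∀ a < r * n, s'.iarr 1 a = s.iarr 1 a))
        (Q := fun s' => (∀ x < n, s'.iarr 0 (r * n + x) = s.iarr 4 x) ∧
          (∀ a < r * n, s'.iarr 0 a = s.iarr 0 a) ∧
          (∀ x < n, s'.iarr 1 (r * n + x) = s.iarr 5 x) ∧ (∀ a < r * n, s'.iarr 1 a = s.iarr 1 a))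
      · intro s' hA
        simp [hA.ivar 0 (by decide), f0]
      · simp [fo0, fo1]
      · intro k s' hk hA hk' ⟨hI₁, hI₂, hI₃, hI₄⟩
        have h0 := hA.ivar 0 (by decide)
        have h1 := hA.ivar 1 (by decide)
        have h4 := hA.iarr 4 (by decide)
        have h5 := hA.iarr 5 (by decide)
        rw [f0] at h0; rw [f1] at h1; rw [f4] at h4; rw [f5] at h5
        have hs : (adr 1 33).Safe W s' := by
          simp [h0, h1, hk']; omega
        apply Runs.istore_seq hs (by simp)
        apply Runs.istore (by simp [h0, h1, hk']; omega) (by simp)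
        simp only [IExp.val, State.putI_ivar, State.putI_iarr, State.setI_iarr, h0, h1, hk', h4, h5,
          if_true, zero_ne_one, one_ne_zero, OfNat.ofNat_ne_zero, if_false]
        refine ⟨fun x hx => ?_, fun a ha => ?_, fun x hx => ?_, fun a ha => ?_⟩
        · by_cases hxk : x = k
          · simp [hxk]
          · simpa [hxk] using hI₁ x (by omega)
        · simpa [show a ≠ r * n + k by omega] using hI₂ a ha
        · by_cases hxk : x = k
          · simp [hxk]
          · simpa [hxk] using hI₃ x (by omega)
        · simpa [show a ≠ r * n + k by omega] using hI₄ a ha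
      · exact fun s' h _ => h
    intro s₂ h₂ hA₂
    have g1 := hA₂.ivar 1 (by decide)
    have g14 := hA₂.rvar 14 (by decide)
    have gc := hA₂.rvar 1 (by decide)
    have gd := hA₂.rarr 0 (by decide)
    have goc := hA₂.rarr 1 (by decide)
    rw [f1] at g1; rw [f14] at g14; rw [fc] at gc; rw [foc] at goc
    apply Runs.rstore_seq (by simp) (by simp)
    apply Runs.iset
    · simp [g1]; omega
    · refine ⟨by simp [g1], fun a ha => ?_, ?_, ?_, ?_, ?_, ?_, fun l hl => ?_⟩
      · simpa [gd] using h₁ a ha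
      · simpa using h₂.1
      · simpa using h₂.2.1
      · simpa using h₂.2.2.1
      · simpa using h₂.2.2.2
      · simp [g1, g14, gc]
      · simp [g1, hl.ne, goc]
  · simp
    have : 1 ≤ n * n := Nat.mul_pos hn0 hn0
    linarith

/-- The residual `d` has row and column square sums at most `n`, and energy at most `E`. -/
structure Bounded (d : ℕ → ℝ) (n : ℕ) (E : ℝ) : Prop where
  row : ∀ k < n, ∑ j ∈ range n, d (k * n + j) ^ 2 ≤ n
  col : ∀ j < n, ∑ k ∈ range n, d (k * n + j) ^ 2 ≤ n
  energy : ∑ k ∈ range n, ∑ j ∈ range n, d (k * n + j) ^ 2 ≤ E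

/-- Subtracting a pruned cut matrix decreases the energy and all row and column square sums. -/
theorem Bounded.update {d d' : ℕ → ℝ} {n : ℕ} {E F σ c : ℝ} {s : State} (h : Bounded d n E)
    (hc : 0 ≤ c) (hσ : σ = 1 ∨ σ = -1) (hP : Pruning true d σ c n F s) (hS : Stable true n s)
    (hT : Stable false n s)
    (hd : ∀ a < n * n, d' a = d a - σ * c * (s.iarr 4 (a / n) * s.iarr 5 (a % n))) :
    Bounded d' n (E - 2 * c * F) := by
  -- The expansion of the square, with `σ² = 1` and 0/1 incidences. Summed over a row or column, the
  -- correction is a line sum of gains, nonnegative by stability.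
  have hkey : ∀ k < n, ∀ j < n, d' (k * n + j) ^ 2 = d (k * n + j) ^ 2 -
      2 * c * ((s.iarr 4 k : ℝ) * ((s.iarr 5 j : ℝ) * gain d σ c n true k j)) := by
    intro k hk j hj
    have e1 : (k * n + j) / n = k := by
      rw [mul_comm, Nat.mul_add_div (by omega), Nat.div_eq_of_lt hj, add_zero]
    have e2 : (k * n + j) % n = j := by
      rw [Nat.mul_add_mod_self_right, Nat.mod_eq_of_lt hj]
    rw [hd _ (adr_lt hk hj), e1, e2]
    have hg : gain d σ c n true k j = σ * d (k * n + j) - c / 2 := rfl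
    rw [hg]
    have hSk : s.iarr 4 k = 0 ∨ s.iarr 4 k = 1 := hP.left k hk
    have hTj : s.iarr 5 j = 0 ∨ s.iarr 5 j = 1 := hP.right j hj
    rcases hσ with rfl | rfl <;> rcases hSk with hSk | hSk <;> rcases hTj with hTj | hTj <;>
      rw [hSk, hTj] <;> push_cast <;> ring
  refine ⟨fun k hk => ?_, fun j hj => ?_, ?_⟩
  · refine le_trans ?_ (h.row k hk)
    rw [sum_congr rfl fun j hj => hkey k hk j (mem_range.1 hj), sum_sub_distrib, ← mul_sum,
      ← mul_sum]
    have hs : s.rarr 5 k = ∑ j ∈ range n, (s.iarr 5 j : ℝ) * gain d σ c n true k j :=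
      hP.sum_left k hk
    rw [← hs]
    have : 0 ≤ (s.iarr 4 k : ℝ) * s.rarr 5 k := by
      rcases Nat.eq_zero_or_pos (s.iarr 4 k) with h0 | h0
      · simp [h0]
      · exact mul_nonneg (Nat.cast_nonneg _) (hS k hk h0)
    have := mul_nonneg (mul_nonneg zero_le_two hc) this
    linarith
  · refine le_trans ?_ (h.col j hj)
    rw [sum_congr rfl fun k hk => hkey k (mem_range.1 hk) j hj, sum_sub_distrib, ← mul_sum]
    have hs : s.rarr 6 j = ∑ k ∈ range n, (s.iarr 4 k : ℝ) * gain d σ c n true k j :=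
      hP.sum_right j hj
    have e : ∑ k ∈ range n, (s.iarr 4 k : ℝ) * ((s.iarr 5 j : ℝ) * gain d σ c n true k j) =
        (s.iarr 5 j : ℝ) * s.rarr 6 j := by
      rw [hs, mul_sum]
      exact sum_congr rfl fun k _ => by ring
    rw [e]
    have : 0 ≤ (s.iarr 5 j : ℝ) * s.rarr 6 j := by
      rcases Nat.eq_zero_or_pos (s.iarr 5 j) with h0 | h0
      · simp [h0]
      · exact mul_nonneg (Nat.cast_nonneg _) (hT j hj h0)
    have := mul_nonneg (mul_nonneg zero_le_two hc) this
    linarith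
  · rw [sum_congr rfl fun k hk => sum_congr rfl fun j hj =>
      hkey k (mem_range.1 hk) j (mem_range.1 hj)]
    simp only [sum_sub_distrib, ← mul_sum]
    have hF : F ≤ ∑ k ∈ range n, (s.iarr 4 k : ℝ) * ∑ j ∈ range n, (s.iarr 5 j : ℝ) *
      gain d σ c n true k j := hP.le
    have := mul_le_mul_of_nonneg_left hF (mul_nonneg zero_le_two hc)
    linarith [h.energy]

/-- The terms `c / 2` cost at most `c n² / 2`, as the cut has at most `n²` entries; half of the
weight remains. -/
theorem GoodCut.le_gain {d : ℕ → ℝ} {n : ℕ} {σ c : ℝ} {S T : ℕ → ℕ} (hc : 0 ≤ c)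
    (h : GoodCut d n σ S T (c * (n * n))) :
    c * (n * n) / 2 ≤ ∑ x ∈ range n, (S x : ℝ) * ∑ y ∈ range n, (T y : ℝ) * gain d σ c n true x y := by
  have hle : ∀ X : ℕ → ℕ, (∀ k < n, X k = 0 ∨ X k = 1) → ∑ k ∈ range n, (X k : ℝ) ≤ n := by
    intro X hX
    calc ∑ k ∈ range n, (X k : ℝ) ≤ ∑ _k ∈ range n, (1 : ℝ) :=
          sum_le_sum fun k hk => by rcases hX k (mem_range.1 hk) with h | h <;> simp [h]
      _ = n := by simp
  have e : ∑ x ∈ range n, (S x : ℝ) * ∑ y ∈ range n, (T y : ℝ) * gain d σ c n true x y =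
      ∑ x ∈ range n, (S x : ℝ) * ∑ y ∈ range n, (T y : ℝ) * (σ * d (x * n + y)) -
      (∑ x ∈ range n, (S x : ℝ)) * (∑ y ∈ range n, (T y : ℝ)) * (c / 2) := by
    rw [sum_mul, sum_mul, ← sum_sub_distrib]
    refine sum_congr rfl fun x _ => ?_
    rw [mul_assoc, ← mul_sub, sum_mul, ← sum_sub_distrib]
    congr 1
    refine sum_congr rfl fun y _ => ?_
    have : gain d σ c n true x y = σ * d (x * n + y) - c / 2 := rfl
    rw [this]
    ring
  rw [e]
  have h1 : (∑ x ∈ range n, (S x : ℝ)) * (∑ y ∈ range n, (T y : ℝ)) ≤ n * n :=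
    mul_le_mul (hle S h.left) (hle T h.right) (sum_nonneg fun _ _ => Nat.cast_nonneg _)
      (Nat.cast_nonneg _)
  have h2 := mul_le_mul_of_nonneg_right h1 (show 0 ≤ c / 2 by linarith)
  linarith [h.le]

/-- The first `r` cuts have been output, and the array `0` holds the residual of the matrix that
was originally stored in `d₀`. -/
structure Residual (d₀ : ℕ → ℝ) (n : ℕ) (c : ℝ) (r : ℕ) (s : State) : Prop where
  size : s.ivar 0 = n
  count : s.ivar 1 = r
  weight : s.rvar 1 = c
  left : ∀ l < r, ∀ x < n, s.iarr 0 (l * n + x) = 0 ∨ s.iarr 0 (l * n + x) = 1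
  right : ∀ l < r, ∀ x < n, s.iarr 1 (l * n + x) = 0 ∨ s.iarr 1 (l * n + x) = 1
  coeff : ∀ l < r, s.rarr 1 l = c ∨ s.rarr 1 l = -c
  residual : ∀ a < n * n, s.rarr 0 a = d₀ a -
    ∑ l ∈ range r, s.rarr 1 l * (s.iarr 0 (l * n + a / n) * s.iarr 1 (l * n + a % n))
  -- Each cut lowers the energy bound by `2 c F` with `F = c n² / 2`.
  bounded : Bounded (s.rarr 0) n ((n : ℝ) ^ 2 - r * (c ^ 2 * (n : ℝ) ^ 2))

/-- The energy cannot become negative; this bounds the number of cuts. -/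
theorem Residual.mul_sq_le {d₀ : ℕ → ℝ} {n r : ℕ} {c : ℝ} {s : State} (h : Residual d₀ n c r s)
    (hn0 : 0 < n) : r * c ^ 2 ≤ 1 := by
  have h1 : (0 : ℝ) ≤ ∑ k ∈ range n, ∑ j ∈ range n, s.rarr 0 (k * n + j) ^ 2 :=
    sum_nonneg fun _ _ => sum_nonneg fun _ _ => sq_nonneg _
  have h2 : (0 : ℝ) < n ^ 2 := by positivity
  have h3 := h.bounded.energy
  have h4 : (r * c ^ 2) * (n : ℝ) ^ 2 ≤ 1 * (n : ℝ) ^ 2 := by nlinarith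
  exact le_of_mul_le_mul_right h4 h2

/-- The spectral norm of the matrix is at most `ε n`. -/
def SmallNorm (d : ℕ → ℝ) (n : ℕ) (ε : ℝ) : Prop :=
  ∀ x : ℕ → ℝ, ∑ k ∈ range n, (∑ j ∈ range n, d (k * n + j) * x j) ^ 2 ≤
    (ε * n) ^ 2 * ∑ j ∈ range n, x j ^ 2

theorem exists_paritySign {σ σ' : ℝ} (h : σ = 1 ∨ σ = -1) (h' : σ' = 1 ∨ σ' = -1) (p : ℕ) :
    ∃ q, q < 4 * p + 4 ∧ q / 4 = p ∧ paritySign q = σ ∧ paritySign (q / 2) = σ' := by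
  rcases h with rfl | rfl <;> rcases h' with rfl | rfl
  · refine ⟨4 * p, by omega, by omega, ?_, ?_⟩
    · rw [paritySign, show 4 * p % 2 = 0 by omega]; norm_num
    · rw [paritySign, show 4 * p / 2 % 2 = 0 by omega]; norm_num
  · refine ⟨4 * p + 2, by omega, by omega, ?_, ?_⟩
    · rw [paritySign, show (4 * p + 2) % 2 = 0 by omega]; norm_num
    · rw [paritySign, show (4 * p + 2) / 2 % 2 = 1 by omega]; norm_num
  · refine ⟨4 * p + 1, by omega, by omega, ?_, ?_⟩
    · rw [paritySign, show (4 * p + 1) % 2 = 1 by omega]; norm_num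
    · rw [paritySign, show (4 * p + 1) / 2 % 2 = 0 by omega]; norm_num
  · refine ⟨4 * p + 3, by omega, by omega, ?_, ?_⟩
    · rw [paritySign, show (4 * p + 3) % 2 = 1 by omega]; norm_num
    · rw [paritySign, show (4 * p + 3) / 2 % 2 = 1 by omega]; norm_num

/-- If no candidate is heavy, then the spectral norm is small. -/
theorem smallNorm_of_candV_lt {d : ℕ → ℝ} {n B u : ℕ} {L : ℕ → ℕ} {ε E : ℝ} (hn : 0 < n)
    (hB0 : 0 < B) (hb : Bounded d n E) (hB : 32 ≤ B * ε ^ 2)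
    (hnu : n ≤ B * B * 16 ^ u) (h : Reach (rowKer d n) n (B * B) u u L)
    (hV : ∀ q < 4 * (B * B),
      candV d n (L (q / 4)) (paritySign q) (paritySign (q / 2)) < ε ^ 8 / 300 * (n * n)) :
    SmallNorm d n ε := by
  refine h.sum_sq_le hn hB0 hb.row hB hnu fun p hp => ?_
  by_contra! hcon
  have hLp : L p < n := h.lt hn p (by simpa using hp)
  -- With `δ = ε ^ 4 / 4` the candidate has weight at least `ε ^ 8 n² / 64`, which leaves room above
  -- the threshold `ε ^ 8 n² / 300`.
  obtain ⟨σ, σ', hσ, hσ', hle⟩ := exists_le_candV (δ := ε ^ 4 / 4) hn hLp (by positivity) hb.row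
    hb.col (by linarith)
  obtain ⟨q, hq, hqp, rfl, rfl⟩ := exists_paritySign hσ hσ' p
  have := hV q (by omega)
  rw [hqp] at this
  have h8 : (0 : ℝ) ≤ ε ^ 8 * n ^ 2 := by positivity
  nlinarith

/-! ### The rounds and the whole algorithm. -/

/-- One round: sample, search for a cut, and subtract it if there is one. -/
def roundProg : Prog :=
  sampleProg ⨟ searchProg ⨟ .ite (.ile (.var 9) (.lit 0)) (.iset 7 (.lit 0)) (pruneProg ⨟ updProg)

/-- Sampling `B²` rows costs order `B⁴ n²` and dominates; the search costs order `B² n²`, pruning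
and updating order `n²`. -/
theorem runs_round {W n r B : ℕ} {d₀ : ℕ → ℝ} {ε : ℝ} {s : State}
    (hR : Residual d₀ n (ε ^ 8 / 300) r s) (h3 : s.ivar 3 = B * B) (h7 : s.ivar 7 = 1)
    (hn0 : 0 < n) (hB0 : 0 < B) (hB : 32 ≤ B * ε ^ 2)
    (hW : n * n ≤ W) (hWM : 17 * (B * B * n) ≤ W) (hWr : (r + 1) * n ≤ W) (hWr' : r + 1 ≤ W) :
    Runs W roundProg s (500000 * (B * B * (B * B) * (n * n))) fun s' =>
      (s'.ivar 7 = 0 ∧ Residual d₀ n (ε ^ 8 / 300) r s' ∧ SmallNorm (s'.rarr 0) n ε) ∨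
      (s'.ivar 7 = 1 ∧ Residual d₀ n (ε ^ 8 / 300) (r + 1) s') := by
  have hM0 : 0 < B * B := Nat.mul_pos hB0 hB0
  have hMn : B * B ≤ B * B * n := Nat.le_mul_of_pos_right _ hn0
  have hMn' : n ≤ B * B * n := Nat.le_mul_of_pos_left _ hM0
  have hc : 0 ≤ ε ^ 8 / 300 := by positivity
  unfold roundProg
  apply Runs.time
  · apply Runs.seq (runs_sample hR.size h3 hM0 hn0 hW hWM)
    rintro s₁ ⟨u, hnu, hu⟩ hA₁
    have f0 := hA₁.ivar 0 (by decide)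
    have f1 := hA₁.ivar 1 (by decide)
    have f3 := hA₁.ivar 3 (by decide)
    have f7 := hA₁.ivar 7 (by decide)
    have fc := hA₁.rvar 1 (by decide)
    have fd := hA₁.rarr 0 (by decide)
    have fo0 := hA₁.iarr 0 (by decide)
    have fo1 := hA₁.iarr 1 (by decide)
    have foc := hA₁.rarr 1 (by decide)
    apply Runs.seq (runs_search (f0.trans hR.size) hn0 (f3.trans h3) hM0
      (fun p hp => hu.lt hn0 p (by simpa using hp)) hW (by omega))
    intro s₂ h₂ hA₂
    have g0 := (hA₂.ivar 0 (by decide)).trans f0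
    have g1 := (hA₂.ivar 1 (by decide)).trans f1
    have g7 := (hA₂.ivar 7 (by decide)).trans f7
    have gc := (hA₂.rvar 1 (by decide)).trans fc
    have gd := (hA₂.rarr 0 (by decide)).trans fd
    have go0 := (hA₂.iarr 0 (by decide)).trans fo0
    have go1 := (hA₂.iarr 1 (by decide)).trans fo1
    have goc := (hA₂.rarr 1 (by decide)).trans foc
    rw [fd, fc, hR.weight] at h₂
    apply Runs.ite_max (by simp)
    · intro hb
      simp at hb
      rcases h₂ with ⟨-, h₂⟩ | ⟨h₂, -⟩
      swap
      · omega
      apply Runs.iset (by simp)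
      refine .inl ⟨by simp, ⟨?_, ?_, ?_, ?_, ?_, ?_, ?_, ?_⟩, ?_⟩
      · simpa [g0] using hR.size
      · simpa [g1] using hR.count
      · simpa [gc] using hR.weight
      · simpa [go0] using hR.left
      · simpa [go1] using hR.right
      · simpa [goc] using hR.coeff
      · simpa [gd, goc, go0, go1] using hR.residual
      · simpa [gd] using hR.bounded
      · simpa [gd] using smallNorm_of_candV_lt hn0 hB0 hR.bounded hB hnu hu h₂
    · intro hb
      simp at hb
      rcases h₂ with ⟨h₂, -⟩ | ⟨-, h₂⟩
      · omega
      have hgain := h₂.le_gain hc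
      apply Runs.seq (runs_prune (F := ε ^ 8 / 300 * (n * n) / 2) (g0.trans hR.size) hn0 hW
        (by omega) h₂.left h₂.right (by rw [gd, gc, hR.weight]; exact hgain))
      rintro s₃ ⟨h₃, h₃S, h₃T⟩ hA₃
      have e0 := (hA₃.ivar 0 (by decide)).trans g0
      have e1 := (hA₃.ivar 1 (by decide)).trans g1
      have e7 := (hA₃.ivar 7 (by decide)).trans g7
      have ec := (hA₃.rvar 1 (by decide)).trans gc
      have e14 := hA₃.rvar 14 (by decide)
      have ed := (hA₃.rarr 0 (by decide)).trans gd
      have eo0 := (hA₃.iarr 0 (by decide)).trans go0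
      have eo1 := (hA₃.iarr 1 (by decide)).trans go1
      have eoc := (hA₃.rarr 1 (by decide)).trans goc
      rw [gd, gc, hR.weight] at h₃
      refine (runs_upd (e0.trans hR.size) hn0 (e1.trans hR.count) hW hWr hWr').mono le_rfl ?_
      rintro s₄ ⟨hr, hd, hS, hS', hT, hT', hC, hC'⟩ hA₄
      have i0 := (hA₄.ivar 0 (by decide)).trans e0
      have i7 := (hA₄.ivar 7 (by decide)).trans e7
      have ic := (hA₄.rvar 1 (by decide)).trans ec
      rw [e14, ec, hR.weight] at hC
      rw [ed, e14, ec, hR.weight] at hd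
      rw [eo0] at hS'
      rw [eo1] at hT'
      rw [eoc] at hC'
      have hlt : ∀ l < r, ∀ x < n, l * n + x < r * n := by
        intro l hl x hx
        have : (l + 1) * n ≤ r * n := Nat.mul_le_mul_right _ hl
        linarith
      refine .inr ⟨i7.trans h7, i0.trans hR.size, hr, ic.trans hR.weight, fun l hl x hx => ?_,
        fun l hl x hx => ?_, fun l hl => ?_, fun a ha => ?_, ?_⟩
      · rcases Nat.lt_succ_iff_lt_or_eq.1 hl with hl | rfl
        · rw [hS' _ (hlt l hl x hx)]; exact hR.left l hl x hx
        · rw [hS x hx]; exact h₃.left x hx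
      · rcases Nat.lt_succ_iff_lt_or_eq.1 hl with hl | rfl
        · rw [hT' _ (hlt l hl x hx)]; exact hR.right l hl x hx
        · rw [hT x hx]; exact h₃.right x hx
      · rcases Nat.lt_succ_iff_lt_or_eq.1 hl with hl | rfl
        · rw [hC' l hl]; exact hR.coeff l hl
        · rw [hC]
          rcases h₂.sign with h | h <;> rw [h] <;> simp
      · have hd1 : a / n < n := Nat.div_lt_of_lt_mul ha
        have hd2 : a % n < n := Nat.mod_lt _ hn0
        rw [hd a ha, hR.residual a ha, sum_range_succ, hC, hS _ hd1, hT _ hd2, sub_sub]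
        congr 2
        refine sum_congr rfl fun l hl => ?_
        have hl := mem_range.1 hl
        rw [hC' l hl, hS' _ (hlt l hl _ hd1), hT' _ (hlt l hl _ hd2)]
      · convert hR.bounded.update hc h₂.sign h₃ h₃S h₃T hd using 1
        push_cast
        ring
  · simp
    have h1 : 1 ≤ n * n := Nat.mul_pos hn0 hn0
    have h2 : B * B * (n * n) ≤ B * B * (B * B) * (n * n) :=
      Nat.mul_le_mul_right _ (Nat.le_mul_self _)
    have h3 : n * n ≤ B * B * (n * n) := Nat.le_mul_of_pos_left _ hM0
    omega

/-- The algorithm. -/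
def mainProg : Prog :=
  .rset 2 (.mul (.var 0) (.var 0)) ⨟ .rset 2 (.mul (.var 2) (.var 2)) ⨟
  .rset 1 (.div (.mul (.var 2) (.var 2)) (.ofNat (.lit 300))) ⨟
  .iset 2 (.lit 1) ⨟
  -- A real cannot be rounded to an integer in this model, so `B` is found by counting up until `32
  -- ≤ B ε²`.
  .loop (.not (.rle (.ofNat (.lit 32)) (.mul (.ofNat (.var 2)) (.mul (.var 0) (.var 0)))))
    (.iset 2 (.add (.var 2) (.lit 1))) ⨟
  .iset 3 (.mul (.var 2) (.var 2)) ⨟ .iset 7 (.lit 1) ⨟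
  .loop (.not (.ile (.var 7) (.lit 0))) roundProg

/-- `B₀` and `R₀` are bounds for the analysis only: the program finds its own `B ≤ B₀` and stops
when a search fails. -/
theorem runs_main {W n B₀ R₀ : ℕ} {ε : ℝ} {s : State} (hn0 : 0 < n) (hs : s.ivar 0 = n)
    (hr : s.ivar 1 = 0) (hε : s.rvar 0 = ε) (hd : Bounded (s.rarr 0) n ((n : ℝ) ^ 2))
    (hB₀ : 32 ≤ B₀ * ε ^ 2) (hR₀ : ∀ r : ℕ, r * (ε ^ 8 / 300) ^ 2 ≤ 1 → r ≤ R₀)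
    (hW : n * n ≤ W) (hWB : 17 * (B₀ * B₀ * n) ≤ W) (hWR : (R₀ + 1) * n ≤ W) (hW3 : 300 ≤ W) :
    Runs W mainProg s (20 * B₀ + 200 +
      (R₀ + 1) * (500000 * (B₀ * B₀ * (B₀ * B₀) * (n * n)) + 20)) fun s' =>
      ∃ r, Residual (s.rarr 0) n (ε ^ 8 / 300) r s' ∧ SmallNorm (s'.rarr 0) n ε := by
  have hB₀0 : 0 < B₀ := by
    rcases Nat.eq_zero_or_pos B₀ with h | h
    · rw [h] at hB₀; norm_num at hB₀
    · exact h
  have hBB : B₀ * B₀ ≤ B₀ * B₀ * n := Nat.le_mul_of_pos_right _ hn0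
  have hBB' : B₀ ≤ B₀ * B₀ := Nat.le_mul_self _
  unfold mainProg
  apply Runs.time
  · apply Runs.rset_seq (by simp)
    apply Runs.rset_seq (by simp)
    apply Runs.rset_seq (by simp; omega)
    apply Runs.iset_seq (by simp; omega)
    apply Runs.seq (T := 20 * B₀ + 20)
      (T' := 50 + (R₀ + 1) * (500000 * (B₀ * B₀ * (B₀ * B₀) * (n * n)) + 20))
    · refine Runs.loop (I := fun τ s' => Residual (s.rarr 0) n (ε ^ 8 / 300) 0 s' ∧
        s'.rvar 0 = ε ∧ 0 < s'.ivar 2 ∧ s'.ivar 2 ≤ B₀ ∧ 20 * (B₀ - s'.ivar 2) + 20 ≤ τ)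
        (Q := fun s' => Residual (s.rarr 0) n (ε ^ 8 / 300) 0 s' ∧
        0 < s'.ivar 2 ∧ s'.ivar 2 ≤ B₀ ∧ 32 ≤ (s'.ivar 2 : ℝ) * ε ^ 2) ?_ ?_
      · rintro τ s' ⟨hR, h0, h2, h2', hτ⟩
        refine ⟨by simp; omega, fun hb => ?_, fun hb => ?_⟩
        · simp [h0] at hb
          exact ⟨⟨hR, h2, h2', by rwa [sq]⟩, by simp; omega⟩
        · simp [h0] at hb
          have hlt : s'.ivar 2 < B₀ := by
            by_contra! hcon
            have : (B₀ : ℝ) ≤ s'.ivar 2 := by exact_mod_cast hcon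
            have h3 := mul_le_mul_of_nonneg_right this (sq_nonneg ε)
            nlinarith
          refine ⟨4, Runs.iset (by simp; omega) ⟨20 * (B₀ - (s'.ivar 2 + 1)) + 20,
            ⟨⟨?_, ?_, ?_, ?_, ?_, ?_, ?_, ?_⟩, ?_, ?_, ?_, ?_⟩, ?_⟩⟩
          · simpa using hR.size
          · simpa using hR.count
          · simpa using hR.weight
          · simp
          · simp
          · simp
          · simpa using hR.residual
          · simpa using hR.bounded
          · simpa using h0
          · simp
          · simpa using hlt
          · simp
          · simp; omega
      · refine ⟨⟨?_, ?_, ?_, ?_, ?_, ?_, ?_, ?_⟩, ?_, ?_, ?_, ?_⟩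
        · simp [hs]
        · simp [hr]
        · simp [hε]; ring
        · simp
        · simp
        · simp
        · simp
        · simpa using hd
        · simp [hε]
        · simp
        · simp; omega
        · simp
    rintro s₁ ⟨hR₁, hB0, hB', hB⟩ hA₁
    set B := s₁.ivar 2 with hBdef
    have hBB₀ : B * B ≤ B₀ * B₀ := Nat.mul_le_mul hB' hB'
    have hBn : B * B * n ≤ B₀ * B₀ * n := Nat.mul_le_mul_right _ hBB₀
    have hT : B * B * (B * B) * (n * n) ≤ B₀ * B₀ * (B₀ * B₀) * (n * n) :=
      Nat.mul_le_mul_right _ (Nat.mul_le_mul hBB₀ hBB₀)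
    refine Runs.time (T := 10 + (10 + (R₀ + 1) *
      (500000 * (B₀ * B₀ * (B₀ * B₀) * (n * n)) + 20))) ?_ (by omega)
    refine (Runs.iset_seq (T := 6 + (10 + (R₀ + 1) *
      (500000 * (B₀ * B₀ * (B₀ * B₀) * (n * n)) + 20))) (by simp [← hBdef]; omega) ?_).time
      (by simp; omega)
    refine (Runs.iset_seq (T := 10 + (R₀ + 1) *
      (500000 * (B₀ * B₀ * (B₀ * B₀) * (n * n)) + 20)) (by simp; omega) ?_).time (by simp)
    -- At most `R₀` rounds find a cut and one more fails, hence `R₀ + 1` rounds in the budget.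
    refine Runs.loop (I := fun τ s' => s'.ivar 3 = B * B ∧ ∃ r,
      Residual (s.rarr 0) n (ε ^ 8 / 300) r s' ∧
      ((s'.ivar 7 = 0 ∧ SmallNorm (s'.rarr 0) n ε ∧ 10 ≤ τ) ∨ (s'.ivar 7 = 1 ∧ 10 + (R₀ + 1 - r) *
        (500000 * (B₀ * B₀ * (B₀ * B₀) * (n * n)) + 20) ≤ τ))) ?_ ?_
    · rintro τ s' ⟨h3, r, hR, h⟩
      refine ⟨by simp, fun hb => ?_, fun hb => ?_⟩
      · simp at hb
        rcases h with ⟨-, h, hτ⟩ | ⟨h, -⟩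
        · exact ⟨⟨r, hR, h⟩, by simp; omega⟩
        · omega
      · simp at hb
        rcases h with ⟨h, -⟩ | ⟨h7, hτ⟩
        · omega
        have hrR : r ≤ R₀ := hR₀ r (hR.mul_sq_le hn0)
        have hWr : (r + 1) * n ≤ W := (Nat.mul_le_mul_right _ (by omega)).trans hWR
        have hWr' : r + 1 ≤ W := (Nat.le_mul_of_pos_right _ hn0).trans hWr
        refine ⟨_, (runs_round hR h3 h7 hn0 hB0 hB hW (by omega) hWr hWr').mono le_rfl ?_⟩
        intro s₂ h₂ hA₂
        have i3 := hA₂.ivar 3 (by decide)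
        obtain ⟨m, hm⟩ : ∃ m, R₀ + 1 - r = m + 1 := ⟨R₀ - r, by omega⟩
        rw [hm, add_mul] at hτ
        rcases h₂ with ⟨h7', hR', hN⟩ | ⟨h7', hR'⟩
        · exact ⟨10, ⟨i3.trans h3, r, hR', .inl ⟨h7', hN, le_rfl⟩⟩, by simp; omega⟩
        · refine ⟨_, ⟨i3.trans h3, r + 1, hR', .inr ⟨h7', le_rfl⟩⟩, ?_⟩
          rw [show R₀ + 1 - (r + 1) = m by omega]
          simp
          omega
    · refine ⟨by simp [hBdef], 0, ⟨?_, ?_, ?_, ?_, ?_, ?_, ?_, ?_⟩, .inr ⟨by simp, by simp⟩⟩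
      · simpa using hR₁.size
      · simpa using hR₁.count
      · simpa using hR₁.weight
      · simp
      · simp
      · simp
      · simpa using hR₁.residual
      · simpa using hR₁.bounded
  · simp
    omega

/-! ### From memory contents to matrices, and the final constants. -/

/-- The residual after the cuts that the memory represents. -/
theorem Residual.sub_cutSum {n r : ℕ} {A : Matrix (Fin n) (Fin n) ℝ} {ε c : ℝ} {s : State}
    (h : Residual ((input ε A).rarr 0) n c r s) (i j : Fin n) :
    (A - cutSum (fun l : Fin r => univ.filter fun i : Fin n => s.iarr 0 (l * n + i) = 1)
      (fun l : Fin r => univ.filter fun i : Fin n => s.iarr 1 (l * n + i) = 1)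
      fun l : Fin r => s.rarr 1 l) i j = s.rarr 0 (i * n + j) := by
  have hn0 : 0 < n := i.pos
  have hlt := adr_lt i.isLt j.isLt
  have e1 : ((i : ℕ) * n + j) / n = i := by
    rw [mul_comm, Nat.mul_add_div hn0, Nat.div_eq_of_lt j.isLt, add_zero]
  have e2 : ((i : ℕ) * n + j) % n = j := by
    rw [Nat.mul_add_mod_self_right, Nat.mod_eq_of_lt j.isLt]
  have hinp : (input ε A).rarr 0 (i * n + j) = A i j := by
    simp [input, hlt, e1, e2]
  rw [h.residual _ hlt, e1, e2, hinp, Matrix.sub_apply, cutSum, Matrix.sum_apply,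
    ← Fin.sum_univ_eq_sum_range (fun l => s.rarr 1 l * ((s.iarr 0 (l * n + i) : ℝ) *
      s.iarr 1 (l * n + j)))]
  congr 1
  refine sum_congr rfl fun l _ => ?_
  simp only [Matrix.smul_apply, Matrix.vecMulVec_apply, charVec, smul_eq_mul, mem_filter,
    mem_univ, true_and]
  rcases h.left l l.isLt i i.isLt with h1 | h1 <;>
    rcases h.right l l.isLt j j.isLt with h2 | h2 <;> simp [h1, h2]

theorem SmallNorm.specNorm_le {d : ℕ → ℝ} {n : ℕ} {ε : ℝ} (h : SmallNorm d n ε) (hε : 0 ≤ ε)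
    {M : Matrix (Fin n) (Fin n) ℝ} (hM : ∀ i j : Fin n, M i j = d (i * n + j)) :
    specNorm M ≤ ε * n := by
  refine ContinuousLinearMap.opNorm_le_bound _ (by positivity) fun x => ?_
  refine abs_le_of_sq_le_sq' ?_ (by positivity) |>.2
  rw [mul_pow, EuclideanSpace.norm_sq_eq, EuclideanSpace.norm_sq_eq]
  have h1 := h fun j => if hj : j < n then x ⟨j, hj⟩ else 0
  rw [← Fin.sum_univ_eq_sum_range (fun k => (∑ j ∈ range n, d (k * n + j) *
    (if hj : j < n then x ⟨j, hj⟩ else 0)) ^ 2), ← Fin.sum_univ_eq_sum_range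
      (fun j => (if hj : j < n then x ⟨j, hj⟩ else 0) ^ 2)] at h1
  refine (le_of_eq (sum_congr rfl fun i _ => ?_)).trans
    (h1.trans (le_of_eq (congrArg _ (sum_congr rfl fun j _ => ?_))))
  · rw [Real.norm_eq_abs, sq_abs, ← Fin.sum_univ_eq_sum_range (fun j => d (i * n + j) *
      (if hj : j < n then x ⟨j, hj⟩ else 0))]
    simp [Matrix.ofLp_toEuclideanCLM, Matrix.mulVec, dotProduct, hM]
  · simp

theorem bounded_input {n : ℕ} {A : Matrix (Fin n) (Fin n) ℝ} {ε : ℝ}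
    (hA : ∀ i j, A i j ∈ Set.Icc (-1 : ℝ) 1) :
    Bounded ((input ε A).rarr 0) n ((n : ℝ) ^ 2) := by
  have h : ∀ a, (input ε A).rarr 0 a ^ 2 ≤ 1 := by
    intro a
    simp only [input, true_and]
    split_ifs with ha
    · rw [sq_le_one_iff_abs_le_one]
      exact abs_le.2 (hA _ _)
    · norm_num
  have h' : ∀ g : ℕ → ℕ, ∑ j ∈ range n, (input ε A).rarr 0 (g j) ^ 2 ≤ n := fun g => by
    calc ∑ j ∈ range n, (input ε A).rarr 0 (g j) ^ 2 ≤ ∑ _j ∈ range n, (1 : ℝ) :=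
          sum_le_sum fun j _ => h _
      _ = n := by simp
  refine ⟨fun k _ => h' _, fun j _ => h' fun k => k * n + j, ?_⟩
  calc ∑ k ∈ range n, ∑ j ∈ range n, (input ε A).rarr 0 (k * n + j) ^ 2
      ≤ ∑ _k ∈ range n, (n : ℝ) := sum_le_sum fun k _ => h' _
    _ = (n : ℝ) ^ 2 := by simp [sq]

theorem nat_le_of_mul_sq_le {ε : ℝ} (hε : 0 < ε) {r : ℕ} (h : r * (ε ^ 8 / 300) ^ 2 ≤ 1) :
    (r : ℝ) ≤ 90000 * ε⁻¹ ^ 16 := by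
  rw [inv_pow, ← div_eq_mul_inv, le_div_iff₀ (by positivity)]
  nlinarith

/-- The rounds contribute `E ^ 16` and the sampling cost `B ^ 4` contributes `E ^ 8`, whence the
exponent 24. -/
theorem steps_le {B R n : ℕ} {E : ℝ} (hE : 1 ≤ E) (hn : 1 ≤ n) (hB : (B : ℝ) ≤ 33 * E ^ 2)
    (hR : (R : ℝ) ≤ 90000 * E ^ 16) :
    ((20 * B + 200 + (R + 1) * (500000 * (B * B * (B * B) * (n * n)) + 20) : ℕ) : ℝ) ≤
      (10 ^ 18 : ℕ) * E ^ 24 * (n : ℝ) ^ 2 := by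
  have hn' : (1 : ℝ) ≤ n ^ 2 := one_le_pow₀ (by exact_mod_cast hn)
  have h16 : 1 ≤ E ^ 16 := one_le_pow₀ hE
  have h24 : 1 ≤ E ^ 24 := one_le_pow₀ hE
  have h2 : E ^ 2 ≤ E ^ 24 := pow_le_pow_right₀ hE (by norm_num)
  have h16' : E ^ 16 ≤ E ^ 24 := pow_le_pow_right₀ hE (by norm_num)
  have hF : E ^ 24 ≤ E ^ 24 * (n : ℝ) ^ 2 := le_mul_of_one_le_right (by positivity) hn'
  have hB4 : (B : ℝ) ^ 4 ≤ 33 ^ 4 * E ^ 8 := by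
    calc (B : ℝ) ^ 4 ≤ (33 * E ^ 2) ^ 4 := by gcongr
      _ = 33 ^ 4 * E ^ 8 := by ring
  have hR' : (R : ℝ) + 1 ≤ 90001 * E ^ 16 := by linarith
  have hP : ((R : ℝ) + 1) * (500000 * ((B : ℝ) ^ 4 * (n : ℝ) ^ 2) + 20) ≤
      90001 * E ^ 16 * (500000 * (33 ^ 4 * E ^ 8 * (n : ℝ) ^ 2) + 20) := by gcongr
  push_cast
  nlinarith

theorem word_le {B R n : ℕ} {E : ℝ} (hE : 1 ≤ E) (hn : 1 ≤ n) (hB : (B : ℝ) ≤ 33 * E ^ 2)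
    (hR : (R : ℝ) ≤ 90000 * E ^ 16) :
    ((n * n + 17 * (B * B * n) + (R + 1) * n + 300 : ℕ) : ℝ) ≤
      (10 ^ 18 : ℕ) * (E * n) ^ 24 := by
  have hn' : (1 : ℝ) ≤ n := by exact_mod_cast hn
  have h16 : 1 ≤ E ^ 16 := one_le_pow₀ hE
  have h24 : 1 ≤ E ^ 24 := one_le_pow₀ hE
  have m1 : (1 : ℝ) ≤ n ^ 24 := one_le_pow₀ hn'
  have m2 : (n : ℝ) ^ 1 ≤ n ^ 24 := pow_le_pow_right₀ hn' (by norm_num)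
  have m3 : (n : ℝ) ^ 2 ≤ n ^ 24 := pow_le_pow_right₀ hn' (by norm_num)
  have e4 : E ^ 4 ≤ E ^ 24 := pow_le_pow_right₀ hE (by norm_num)
  have e16 : E ^ 16 ≤ E ^ 24 := pow_le_pow_right₀ hE (by norm_num)
  have hB2 : (B : ℝ) ^ 2 ≤ 33 ^ 2 * E ^ 24 := by
    calc (B : ℝ) ^ 2 ≤ (33 * E ^ 2) ^ 2 := by gcongr
      _ = 33 ^ 2 * E ^ 4 := by ring
      _ ≤ _ := by gcongr
  have t1 : (n : ℝ) ^ 2 ≤ E ^ 24 * n ^ 24 := m3.trans (le_mul_of_one_le_left (by positivity) h24)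
  have t2 : (B : ℝ) ^ 2 * n ≤ 33 ^ 2 * E ^ 24 * n ^ 24 :=
    mul_le_mul hB2 (by simpa using m2) (by positivity) (by positivity)
  have t3 : ((R : ℝ) + 1) * n ≤ 90001 * E ^ 24 * n ^ 24 :=
    mul_le_mul (by linarith) (by simpa using m2) (by positivity) (by positivity)
  have t4 : 1 ≤ E ^ 24 * (n : ℝ) ^ 24 := one_le_mul_of_one_le_of_one_le h24 m1
  push_cast
  rw [mul_pow]
  nlinarith

end RealRAM

theorem theorem2p1 :
    ∃ (p : RealRAM.Prog) (C k : ℕ),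
      ∀ (n : ℕ) (ε : ℝ) (A : Matrix (Fin n) (Fin n) ℝ),
        0 < n → 0 < ε → (∀ i j, A i j ∈ Set.Icc (-1 : ℝ) 1) →
        ∃ (W t : ℕ) (s : RealRAM.State) (r : ℕ)
          (S T : Fin r → Finset (Fin n)) (c : Fin r → ℝ),
          -- the words have at most `O(log (n / ε))` bits, enough to hold `n`
          n ≤ W ∧ (W : ℝ) ≤ C * (max 1 ε⁻¹ * n) ^ k ∧
          -- the program halts after `t` steps with the output `r, S, T, c`
          RealRAM.Exec W p (RealRAM.input ε A) t s ∧
          RealRAM.Outputs s S T c ∧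
          (t : ℝ) ≤ C * (max 1 ε⁻¹) ^ k * (n : ℝ) ^ 2 ∧
          -- the guarantees on the output
          (r : ℝ) ≤ C * ε⁻¹ ^ 16 ∧
          (∀ l, c l = ε ^ 8 / 300 ∨ c l = -(ε ^ 8 / 300)) ∧
          (∀ i, ∑ j, ((A - cutSum S T c) i j) ^ 2 ≤ n) ∧
          (∀ j, ∑ i, ((A - cutSum S T c) i j) ^ 2 ≤ n) ∧
          specNorm (A - cutSum S T c) ≤ ε * n := by
  refine ⟨RealRAM.mainProg, 10 ^ 18, 24, fun n ε A hn hε hA => ?_⟩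
  set E : ℝ := max 1 ε⁻¹ with hE
  have hE1 : 1 ≤ E := le_max_left _ _
  have hEε : 1 ≤ E * ε := by
    calc 1 = ε⁻¹ * ε := (inv_mul_cancel₀ hε.ne').symm
      _ ≤ E * ε := mul_le_mul_of_nonneg_right (le_max_right _ _) hε.le
  -- `E ε ≥ 1` gives `32 ≤ B ε²`; rounding up turns 32 into at most 33, as `E ≥ 1`.
  set B : ℕ := ⌈32 * E ^ 2⌉₊ with hBdef
  set R : ℕ := ⌊90000 * ε⁻¹ ^ 16⌋₊ with hRdef
  have hB : (B : ℝ) ≤ 33 * E ^ 2 := by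
    have h1 : (B : ℝ) < 32 * E ^ 2 + 1 := Nat.ceil_lt_add_one (by positivity)
    have h2 : 1 ≤ E ^ 2 := one_le_pow₀ hE1
    linarith
  have hBε : 32 ≤ B * ε ^ 2 := by
    calc (32 : ℝ) ≤ 32 * (E * ε) ^ 2 := by linarith [one_le_pow₀ hEε (n := 2)]
      _ = 32 * E ^ 2 * ε ^ 2 := by ring
      _ ≤ B * ε ^ 2 := mul_le_mul_of_nonneg_right (Nat.le_ceil _) (sq_nonneg _)
  have hR : (R : ℝ) ≤ 90000 * E ^ 16 :=
    (Nat.floor_le (by positivity)).trans (mul_le_mul_of_nonneg_left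
      (pow_le_pow_left₀ (by positivity) (le_max_right _ _) _) (by norm_num))
  have hnn : n ≤ n * n := Nat.le_mul_self n
  obtain ⟨t, s, hex, ht, r, hres, hsmall⟩ := RealRAM.runs_main
    -- The summands make room for the addresses of the residual, the initial sampling list, the
    -- output tables and the literal 300.
    (W := n * n + 17 * (B * B * n) + (R + 1) * n + 300) (s := RealRAM.input ε A) (R₀ := R) hn
    (by simp [RealRAM.input]) (by simp [RealRAM.input]) (by simp [RealRAM.input])
    (RealRAM.bounded_input hA) hBε
    (fun r hr => Nat.le_floor (RealRAM.nat_le_of_mul_sq_le hε hr))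
    (by omega) (by omega) (by omega) (by omega)
  have hsub := hres.sub_cutSum
  have hr := RealRAM.nat_le_of_mul_sq_le hε (hres.mul_sq_le hn)
  have hr0 : (0 : ℝ) ≤ ε⁻¹ ^ 16 := by positivity
  refine ⟨n * n + 17 * (B * B * n) + (R + 1) * n + 300, t, s, r, _, _, _, by omega,
    RealRAM.word_le hE1 hn hB hR, hex, ⟨hres.count, fun l i => ?_, fun l i => ?_, fun l => rfl⟩,
    (Nat.cast_le.2 ht).trans (RealRAM.steps_le hE1 hn hB hR), by push_cast; linarith,
    fun l => hres.coeff l l.isLt, fun i => ?_, fun j => ?_, hsmall.specNorm_le hε.le hsub⟩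
  · rcases hres.left l l.isLt i i.isLt with h | h <;> simp [h]
  · rcases hres.right l l.isLt i i.isLt with h | h <;> simp [h]
  · simp only [hsub]
    rw [Fin.sum_univ_eq_sum_range fun j => s.rarr 0 (i * n + j) ^ 2]
    exact hres.bounded.row i i.isLt
  · simp only [hsub]
    rw [Fin.sum_univ_eq_sum_range fun i => s.rarr 0 (i * n + j) ^ 2]
    exact hres.bounded.col j j.isLt
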